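/- All systems are finite-dimensional, $\mathsf S$ is the von Neumann entropy, $I(A{:}B)=\mathsf S(A)+\mathsf S(B)-\mathsf S(AB)$, and $\log$ is taken to any fixed base. **Model.** A secret $\mathcal S$ of dimension $M$, purified by a reference system $\mathcal R$ (so $\mathcal{SR}$ is in a pure state), is encoded by a quantum operation (a completely positive trace-preserving map) into shares $S_1,\dots,S_n$. For $D\subseteq[n]$ and $j\in D$, a quantum operation $\pi_{j,D}$ acts on $S_j$ and produces the partial share $H_{j,D}$, which party $j$ sends to the combiner when the set $D$ is accessed; $S_A$ denotes the joint system of the shares $S_j$, $j\in A$, and $H_{D,D}$ the joint system of the $H_{j,D}$, $j\in D$. We say that $S_A$ (respectively $H_{D,D}$) recovers the secret if $I(\mathcal R{:}S_A)=I(\mathcal R{:}\mathcal S)$ (respectively $I(\mathcal R{:}H_{D,D})=I(\mathcal R{:}\mathcal S)$), and that $S_B$ has no information on the secret if $I(\mathcal R{:}S_B)=0$. Put $\mathrm{CC}_n(d)=\max_{|D|=d}\sum_{j\in D}\log\dim H_{j,D}$. The following conditions are required for every state of the secret and every purification of it. * A $((k,n))$ threshold scheme: $S_A$ recovers the secret whenever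 $|A|\ge k$, and $S_B$ has no information on it whenever $|B|<k$. * A $((k,n,d))$ CE-QTS scheme: a $((k,n))$ threshold scheme such that moreover $H_{D,D}$ recovers the secret whenever $|D|=d$, and $\mathrm{CC}_n(d)<\max_{|A|=k}\sum_{j\in A}\log\dim S_j$. * A $((k,n,*))$ universal CE-QTS scheme: $H_{D,D}$ recovers the secret whenever $|D|\ge k$, $S_B$ has no information on it whenever $|B|<k$, and $\mathrm{CC}_n(n)<\mathrm{CC}_n(n-1)<\dots<\mathrm{CC}_n(k)$. **Theorem.** Let $1\le k\le d\le n$ and let $D\subseteq[n]$ with $|D|=d$. 1. For every state of the secret and every purification of it such that $S_B$ has no information on the secret for every $|B|<k$ and $H_{D,D}$ recovers the secret, $$\sum_{j\in D}\mathsf S(H_{j,D})\ \ge\ \frac{d}{d-k+1}\,\mathsf S(\mathcal S).$$ 2. In every $((k,n))$ threshold scheme in which $H_{D,D}$ recovers every secret, and also in every $((k,n,d))$ CE-QTS scheme and in every $((k,n,*))$ universal CE-QTS scheme, the state sent to the combiner by the parties in $D$ lives in a Hilbert space of dimension $$\prod_{j\in D}\dim H_{j,D}\ \ge\ M^{d/(d-k+1)}.$$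 -/

import Mathlib

namespace QSS

noncomputable section

open scoped ComplexOrder

/-! ### Finite-dimensional quantum systems

A system with Hilbert space `ℂ^A` is given by the finite index type `A` of an orthonormal basis; its
operators are the matrices `Matrix A A ℂ`, and `A × B` indexes the tensor product `ℂ^A ⊗ ℂ^B`. -/

/-- Partial trace over the second factor. -/
def trRight {A B : Type*} [Fintype B] (ρ : Matrix (A × B) (A × B) ℂ) : Matrix A A ℂ :=
  Matrix.of fun a a' => ∑ b, ρ (a, b) (a', b)

/-- Partial trace over the first factor. -/
def trLeft {A B : Type*} [Fintype A] (ρ : Matrix (A × B) (A × B) ℂ) : Matrix B B ℂ :=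
  Matrix.of fun b b' => ∑ a, ρ (a, b) (a, b')

/-- The von Neumann entropy `-∑ λ log λ` over the eigenvalues (with multiplicity) of a Hermitian
matrix, with the natural logarithm. Density matrices are Hermitian, so the value `0` for
non-Hermitian matrices is never used. -/
def entropy {A : Type*} [Fintype A] [DecidableEq A] (ρ : Matrix A A ℂ) : ℝ :=
  open Classical in
  if h : ρ.IsHermitian then ∑ i, Real.negMulLog (h.eigenvalues i) else 0

/-- The mutual information `I(A:B) = S(A) + S(B) - S(AB)` of a bipartite state. -/
def mutualInfo {A B : Type*} [Fintype A] [DecidableEq A] [Fintype B] [DecidableEq B]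
    (ρ : Matrix (A × B) (A × B) ℂ) : ℝ :=
  entropy (trRight ρ) + entropy (trLeft ρ) - entropy ρ

/-- A state vector: a vector of Euclidean norm one. -/
def IsUnitVector {A : Type*} [Fintype A] (ψ : A → ℂ) : Prop :=
  ∑ a, ‖ψ a‖ ^ 2 = 1

/-- The pure state `|ψ⟩⟨ψ|`. -/
def pureState {A : Type*} (ψ : A → ℂ) : Matrix A A ℂ :=
  Matrix.vecMulVec ψ (star ψ)

/-- `id_R ⊗ Φ` for a linear map `Φ` on operators: `Φ` is applied to every `R`-block. -/
def idTensor {A B : Type*} (R : Type*) (Φ : Matrix A A ℂ →ₗ[ℂ] Matrix B B ℂ)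
    (X : Matrix (R × A) (R × A) ℂ) : Matrix (R × B) (R × B) ℂ :=
  Matrix.of fun p q => Φ (Matrix.of fun a a' => X (p.1, a) (q.1, a')) p.2 q.2

/-- A quantum operation (quantum channel): a completely positive trace-preserving linear map on
operators. -/
structure QuantumOp (A B : Type*) [Fintype A] [Fintype B] where
  map : Matrix A A ℂ →ₗ[ℂ] Matrix B B ℂ
  trace_map : ∀ X, (map X).trace = X.trace
  completely_positive : ∀ (r : ℕ) (X : Matrix (Fin r × A) (Fin r × A) ℂ),
    X.PosSemidef → (idTensor (Fin r) map X).PosSemidef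

/-- `id_R ⊗ ⨂ᵢ Φᵢ` for linear maps `Φᵢ` on operators, written out on matrix units:
`|ρ⟩⟨ρ'| ⊗ ⨂ᵢ |xᵢ⟩⟨x'ᵢ|` is sent to `|ρ⟩⟨ρ'| ⊗ ⨂ᵢ Φᵢ(|xᵢ⟩⟨x'ᵢ|)`. -/
def idTensorPi {ι : Type*} [Fintype ι] [DecidableEq ι] {A B : ι → Type*}
    [∀ i, Fintype (A i)] [∀ i, DecidableEq (A i)] (R : Type*)
    (Φ : ∀ i, Matrix (A i) (A i) ℂ →ₗ[ℂ] Matrix (B i) (B i) ℂ)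
    (X : Matrix (R × ∀ i, A i) (R × ∀ i, A i) ℂ) :
    Matrix (R × ∀ i, B i) (R × ∀ i, B i) ℂ :=
  Matrix.of fun p q => ∑ x : ∀ i, A i, ∑ x' : ∀ i, A i,
    X (p.1, x) (q.1, x') * ∏ i, Φ i (Matrix.single (x i) (x' i) 1) (p.2 i) (q.2 i)

/-- The reduced state on `R` and the systems in `S`, for a state of `R` and a family of systems. -/
def reduceTo {ι : Type*} [Fintype ι] [DecidableEq ι] {A : ι → Type*} [∀ i, Fintype (A i)]
    {R : Type*} (S : Finset ι) (X : Matrix (R × ∀ i, A i) (R × ∀ i, A i) ℂ) :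
    Matrix (R × ∀ i : {i // i ∈ S}, A i) (R × ∀ i : {i // i ∈ S}, A i) ℂ :=
  let e : (R × ∀ i, A i) ≃ (R × ∀ i : {i // i ∈ S}, A i) × ∀ i : {i // ¬ i ∈ S}, A i :=
    ((Equiv.refl R).prodCongr (Equiv.piEquivPiSubtypeProd (fun i => i ∈ S) A)).trans
      (Equiv.prodAssoc _ _ _).symm
  trRight (Matrix.reindex e e X)

/-- The reduced state of the single system `j`, for a state of a family of systems. -/
def reduceToSingle {ι : Type*} [Fintype ι] [DecidableEq ι] {A : ι → Type*} [∀ i, Fintype (A i)]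
    (j : ι) (X : Matrix (∀ i, A i) (∀ i, A i) ℂ) : Matrix (A j) (A j) ℂ :=
  trRight (Matrix.reindex (Equiv.piSplitAt j A) (Equiv.piSplitAt j A) X)

/-! ### Secret sharing with partial shares -/

/-- The data of a secret sharing protocol for a secret of dimension `M` among `n` parties: the
encoding of the secret into `n` shares and, for every set `D` of parties and every party `j ∈ D`,
the operation by which `j` produces from its share the partial share `H_{j,D}` that it sends to the
combiner when `D` is accessed. -/
structure Protocol (n M : ℕ) where
  shareDim : Fin n → ℕ
  partialDim : (D : Finset (Fin n)) → {j // j ∈ D} → ℕ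
  encode : QuantumOp (Fin M) (∀ j, Fin (shareDim j))
  partialOp : (D : Finset (Fin n)) → (j : {j // j ∈ D}) →
    QuantumOp (Fin (shareDim j)) (Fin (partialDim D j))

namespace Protocol

variable {n M : ℕ} (P : Protocol n M) {r : ℕ}

/-- The density matrix of the secret with purification `ψ` (the first factor is the reference
system). -/
def secretState {M r : ℕ} (ψ : Fin r × Fin M → ℂ) : Matrix (Fin M) (Fin M) ℂ :=
  trLeft (pureState ψ)

/-- The joint state of the reference system and all shares. -/
def sharesState (ψ : Fin r × Fin M → ℂ) :
    Matrix (Fin r × ∀ j, Fin (P.shareDim j)) (Fin r × ∀ j, Fin (P.shareDim j)) ℂ :=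
  idTensor (Fin r) P.encode.map (pureState ψ)

/-- The state of the single share `S_j`. -/
def shareState (ψ : Fin r × Fin M → ℂ) (j : Fin n) :
    Matrix (Fin (P.shareDim j)) (Fin (P.shareDim j)) ℂ :=
  reduceToSingle j (P.encode.map (secretState ψ))

/-- The joint state of the reference system and the partial shares `H_{D,D}`. -/
def partialsState (ψ : Fin r × Fin M → ℂ) (D : Finset (Fin n)) :
    Matrix (Fin r × ∀ j, Fin (P.partialDim D j)) (Fin r × ∀ j, Fin (P.partialDim D j)) ℂ :=
  idTensorPi (Fin r) (fun j => (P.partialOp D j).map) (reduceTo D (P.sharesState ψ))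

/-- The state of the single partial share `H_{j,D}`. -/
def partialState (ψ : Fin r × Fin M → ℂ) (D : Finset (Fin n)) (j : {j // j ∈ D}) :
    Matrix (Fin (P.partialDim D j)) (Fin (P.partialDim D j)) ℂ :=
  (P.partialOp D j).map (P.shareState ψ j)

/-- `I(R : S_A) = I(R : S)`: the shares in `A` recover the secret purified by `ψ`. -/
def SharesRecover (ψ : Fin r × Fin M → ℂ) (A : Finset (Fin n)) : Prop :=
  mutualInfo (reduceTo A (P.sharesState ψ)) = mutualInfo (pureState ψ)

/-- `I(R : H_{D,D}) = I(R : S)`: the partial shares of `D` recover the secret purified by `ψ`. -/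
def PartialsRecover (ψ : Fin r × Fin M → ℂ) (D : Finset (Fin n)) : Prop :=
  mutualInfo (P.partialsState ψ D) = mutualInfo (pureState ψ)

/-- `I(R : S_B) = 0`: the shares in `B` have no information on the secret purified by `ψ`. -/
def NoInformation (ψ : Fin r × Fin M → ℂ) (B : Finset (Fin n)) : Prop :=
  mutualInfo (reduceTo B (P.sharesState ψ)) = 0

/-- Secrecy of a scheme with threshold `k`, for every secret. -/
def Secrecy (k : ℕ) : Prop :=
  ∀ (r : ℕ) (ψ : Fin r × Fin M → ℂ), IsUnitVector ψ →
    ∀ B : Finset (Fin n), B.card < k → P.NoInformation ψ B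

/-- Recoverability from any `k` or more full shares, for every secret. -/
def ShareRecoverability (k : ℕ) : Prop :=
  ∀ (r : ℕ) (ψ : Fin r × Fin M → ℂ), IsUnitVector ψ →
    ∀ A : Finset (Fin n), k ≤ A.card → P.SharesRecover ψ A

/-- Recoverability from the partial shares of `D`, for every secret. -/
def PartialRecoverability (D : Finset (Fin n)) : Prop :=
  ∀ (r : ℕ) (ψ : Fin r × Fin M → ℂ), IsUnitVector ψ → P.PartialsRecover ψ D

/-- The communication cost `max_{|D| = d} ∑_{j ∈ D} log dim H_{j,D}`, up to the choice of the
base of the logarithm. -/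
def partialCost (d : ℕ) : ℝ :=
  ⨆ D : {D : Finset (Fin n) // D.card = d}, ∑ j : {j // j ∈ D.1}, Real.log (P.partialDim D.1 j)

/-- The communication cost `max_{|A| = k} ∑_{j ∈ A} log dim S_j` of sending `k` full shares, up to
the choice of the base of the logarithm. -/
def shareCost (k : ℕ) : ℝ :=
  ⨆ A : {A : Finset (Fin n) // A.card = k}, ∑ j ∈ A.1, Real.log (P.shareDim j)

/-- A `((k,n))` quantum threshold secret sharing scheme. -/
def IsThresholdScheme (k : ℕ) : Prop :=
  P.ShareRecoverability k ∧ P.Secrecy k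

/-- A `((k,n,d))` communication efficient quantum threshold secret sharing scheme. -/
def IsCEQTS (k d : ℕ) : Prop :=
  P.ShareRecoverability k ∧ (∀ D : Finset (Fin n), D.card = d → P.PartialRecoverability D) ∧
    P.Secrecy k ∧ P.partialCost d < P.shareCost k

/-- A `((k,n,*))` universal communication efficient quantum threshold secret sharing scheme. -/
def IsUniversalCEQTS (k : ℕ) : Prop :=
  (∀ D : Finset (Fin n), k ≤ D.card → P.PartialRecoverability D) ∧ P.Secrecy k ∧
    ∀ d d' : ℕ, k ≤ d → d < d' → d' ≤ n → P.partialCost d' < P.partialCost d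

end Protocol

end

end QSS

namespace QSS

open Matrix Polynomial
open scoped ComplexOrder Kronecker

/-! ### Entropy as a function of the spectrum -/

/-! Split the accessed set `D` into `L` with `d - k + 1` parties and a rest `L'` with `k - 1`
parties, and write `s` for the entropy of the secret, which is also that of the reference `R`.
Before the partial operations `R` and the shares of `L'` are in a product state; local operations
keep it a product, so S(R H_L') = s + S(H_L'). Recovery by `D` says S(H_D) - S(R H_D) = s.
Araki-Lieb gives S(R H_L') ≤ S(R H_D) + S(H_L), and subadditivity gives S(H_D) ≤ S(H_L) + S(H_L').
Adding these, S(R H_D) and S(H_L') cancel and s ≤ S(H_L) remains, hence s is at most the sum of the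
entropies of the partial shares in `L` (`entropy_secretState_le_sum`). Strong subadditivity is not
needed.

Averaging over cyclic windows `L` of size `d - k + 1` gives the factor d / (d - k + 1)
(`card_mul_le_of_forall_card_eq`). For the dimension bound, take a maximally entangled secret, for
which s = log M, and bound each entropy by the logarithm of the dimension.

The analytic input is Klein's inequality with its equality case (`klein`). It yields `subadditivity`
together with the fact that zero mutual information forces a product state; purification then yields
`entropy_trRight_le`. The remaining work is bookkeeping of partial traces (`marg`) and of tensor
products of channels (`idTensorPi`). -/

theorem entropy_of_isHermitian {A : Type*} [Fintype A] [DecidableEq A] {ρ : Matrix A A ℂ}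
    (h : ρ.IsHermitian) : entropy ρ = ∑ i, Real.negMulLog (h.eigenvalues i) := by
  simp [entropy, h]

/-- Makes the entropy a function of the characteristic polynomial alone, so that invariance under
relabelling, transposition and unitary conjugation becomes an identity of polynomials. -/
theorem entropy_eq_sum_roots {A : Type*} [Fintype A] [DecidableEq A] {ρ : Matrix A A ℂ}
    (h : ρ.IsHermitian) :
    entropy ρ = (ρ.charpoly.roots.map fun z => Real.negMulLog z.re).sum := by
  rw [entropy_of_isHermitian h, h.roots_charpoly_eq_eigenvalues, Multiset.map_map]
  simp [Function.comp_def]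

theorem entropy_congr_charpoly {A B : Type*} [Fintype A] [DecidableEq A] [Fintype B]
    [DecidableEq B] {ρ : Matrix A A ℂ} {σ : Matrix B B ℂ} (hρ : ρ.IsHermitian)
    (hσ : σ.IsHermitian) (h : ρ.charpoly = σ.charpoly) : entropy ρ = entropy σ := by
  rw [entropy_eq_sum_roots hρ, entropy_eq_sum_roots hσ, h]

theorem entropy_submatrix_equiv {A B : Type*} [Fintype A] [DecidableEq A] [Fintype B]
    [DecidableEq B] {ρ : Matrix A A ℂ} (hρ : ρ.IsHermitian) (e : B ≃ A) :
    entropy (ρ.submatrix e e) = entropy ρ := by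
  refine entropy_congr_charpoly (hρ.submatrix e) hρ ?_
  simpa using Matrix.charpoly_reindex e.symm ρ

theorem entropy_transpose {A : Type*} [Fintype A] [DecidableEq A] {ρ : Matrix A A ℂ}
    (hρ : ρ.IsHermitian) : entropy ρᵀ = entropy ρ :=
  entropy_congr_charpoly hρ.transpose hρ (Matrix.charpoly_transpose ρ)

/-- The two characteristic polynomials agree up to powers of `X`, and the extra zero eigenvalues
contribute nothing because `Real.negMulLog 0 = 0`. -/
theorem entropy_mul_conjTranspose_comm {A B : Type*} [Fintype A] [DecidableEq A] [Fintype B]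
    [DecidableEq B] (C : Matrix A B ℂ) : entropy (C * Cᴴ) = entropy (Cᴴ * C) := by
  rw [entropy_eq_sum_roots (isHermitian_mul_conjTranspose_self C),
    entropy_eq_sum_roots (isHermitian_conjTranspose_mul_self C)]
  have h := congrArg Polynomial.roots (Matrix.charpoly_mul_comm' C Cᴴ)
  rw [roots_mul (mul_ne_zero (pow_ne_zero _ X_ne_zero) (Matrix.charpoly_monic _).ne_zero),
    roots_mul (mul_ne_zero (pow_ne_zero _ X_ne_zero) (Matrix.charpoly_monic _).ne_zero)] at h
  have h2 := congrArg (fun s => (Multiset.map (fun z : ℂ => Real.negMulLog z.re) s).sum) h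
  simpa [Multiset.map_nsmul, Multiset.sum_nsmul] using h2

theorem entropy_unitary_conj {A : Type*} [Fintype A] [DecidableEq A] {ρ : Matrix A A ℂ}
    (hρ : ρ.IsHermitian) {W : Matrix A A ℂ} (hW : W * Wᴴ = 1) :
    entropy (Wᴴ * ρ * W) = entropy ρ := by
  refine entropy_congr_charpoly (isHermitian_conjTranspose_mul_mul W hρ) hρ ?_
  rw [Matrix.charpoly_mul_comm, ← Matrix.mul_assoc, hW, Matrix.one_mul]

theorem entropy_diagonal {A : Type*} [Fintype A] [DecidableEq A] (q : A → ℝ) :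
    entropy (diagonal fun a => (q a : ℂ)) = ∑ a, Real.negMulLog (q a) := by
  rw [entropy_eq_sum_roots, Matrix.charpoly_diagonal]
  · have h := roots_multiset_prod_X_sub_C (Finset.univ.val.map fun a => (q a : ℂ))
    rw [Multiset.map_map] at h
    rw [show ∏ a, (X - C (q a : ℂ)) = (Multiset.map ((fun z => X - C z) ∘ fun a => (q a : ℂ))
      Finset.univ.val).prod from rfl, h, Multiset.map_map]
    simp
  · exact isHermitian_diagonal_of_self_adjoint _ (by ext; simp)

/-- Unitary diagonalisation of a positive semidefinite matrix. -/
theorem exists_diagonalization {A : Type*} [Fintype A] [DecidableEq A] {ρ : Matrix A A ℂ}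
    (hρ : ρ.PosSemidef) : ∃ (U : Matrix A A ℂ) (p : A → ℝ), U * Uᴴ = 1 ∧ Uᴴ * U = 1 ∧
      (∀ a, 0 ≤ p a) ∧ ρ = U * (diagonal fun a => (p a : ℂ)) * Uᴴ := by
  refine ⟨hρ.1.eigenvectorUnitary, hρ.1.eigenvalues, ?_, ?_, hρ.eigenvalues_nonneg, ?_⟩
  · exact Unitary.mul_star_self_of_mem hρ.1.eigenvectorUnitary.2
  · exact Unitary.star_mul_self_of_mem hρ.1.eigenvectorUnitary.2
  · exact hρ.1.spectral_theorem

theorem entropy_conj_diagonal {A : Type*} [Fintype A] [DecidableEq A] {U : Matrix A A ℂ}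
    {p : A → ℝ} (hU : Uᴴ * U = 1) :
    entropy (U * (diagonal fun a => (p a : ℂ)) * Uᴴ) = ∑ a, Real.negMulLog (p a) := by
  rw [← entropy_diagonal]
  have h := entropy_unitary_conj (ρ := diagonal fun a => (p a : ℂ)) (W := Uᴴ)
    (isHermitian_diagonal_of_self_adjoint _ (by ext; simp)) (by simpa using hU)
  simpa using h

theorem exists_eq_mul_conjTranspose {A : Type*} [Fintype A] [DecidableEq A] {ρ : Matrix A A ℂ}
    (hρ : ρ.PosSemidef) : ∃ C : Matrix A A ℂ, ρ = C * Cᴴ := by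
  obtain ⟨U, p, -, -, hp, rfl⟩ := exists_diagonalization hρ
  refine ⟨U * diagonal fun a => ((Real.sqrt (p a) : ℝ) : ℂ), ?_⟩
  rw [conjTranspose_mul, diagonal_conjTranspose, Matrix.mul_assoc, Matrix.mul_assoc,
    ← Matrix.mul_assoc (diagonal _), diagonal_mul_diagonal]
  congr 3
  ext a
  simp [← Complex.ofReal_mul, Real.mul_self_sqrt (hp a)]

/-! ### Klein's inequality -/

/-- This is `log x ≤ x - 1` at `x = q / p`, multiplied by `p`. -/
theorem klein_term_nonneg {p q : ℝ} (hp : 0 ≤ p) (hq : 0 < q) :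
    0 ≤ p * Real.log p - p * Real.log q - p + q := by
  rcases hp.eq_or_lt with rfl | hp
  · simpa using hq.le
  · have h := Real.log_le_sub_one_of_pos (div_pos hq hp)
    rw [Real.log_div hq.ne' hp.ne'] at h
    have h2 := mul_le_mul_of_nonneg_left h hp.le
    have h3 : p * (q / p - 1) = q - p := by field_simp
    linarith

theorem klein_term_eq_zero {p q : ℝ} (hp : 0 ≤ p) (hq : 0 < q)
    (h : p * Real.log p - p * Real.log q - p + q = 0) : p = q := by
  rcases hp.eq_or_lt with rfl | hp
  · simpa using h.symm
  · by_contra hne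
    have h1 := Real.log_lt_sub_one_of_pos (div_pos hq hp)
      (fun h => hne ((div_eq_one_iff_eq hp.ne').1 h).symm)
    rw [Real.log_div hq.ne' hp.ne'] at h1
    have h2 := mul_lt_mul_of_pos_left h1 hp
    have h3 : p * (q / p - 1) = q - p := by field_simp
    linarith

/-- Klein's inequality for the relative entropy to a diagonal matrix, with its equality case. -/
theorem klein {A : Type*} [Fintype A] [DecidableEq A] {σ : Matrix A A ℂ} (hσ : σ.PosSemidef)
    {q : A → ℝ} (hq : ∀ m, 0 ≤ q m) (htr : ∑ m, q m = ∑ m, (σ m m).re)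
    (hz : ∀ m, q m = 0 → (σ m m).re = 0) :
    entropy σ ≤ -∑ m, (σ m m).re * Real.log (q m) ∧
      (entropy σ = -∑ m, (σ m m).re * Real.log (q m) → σ = diagonal fun m => (q m : ℂ)) := by
  obtain ⟨V, p, hV, hV', hp, rfl⟩ := exists_diagonalization hσ
  set σ := V * (diagonal fun a => (p a : ℂ)) * Vᴴ with hσdef
  have hdiag : ∀ m, (σ m m).re = ∑ i, ‖V m i‖ ^ 2 * p i := by
    intro m
    rw [hσdef, mul_apply, Complex.re_sum]
    refine Finset.sum_congr rfl fun i _ => ?_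
    rw [mul_diagonal, conjTranspose_apply, mul_right_comm, Complex.star_def, Complex.mul_conj, Complex.normSq_eq_norm_sq,
      ← Complex.ofReal_mul, Complex.ofReal_re]
  have hcol : ∀ i, ∑ m, ‖V m i‖ ^ 2 = 1 := by
    intro i
    have h := congrFun (congrFun hV' i) i
    simp only [mul_apply, conjTranspose_apply, one_apply_eq] at h
    have h2 := congrArg Complex.re h
    simp only [Complex.re_sum, Complex.one_re] at h2
    rw [← h2]
    refine Finset.sum_congr rfl fun m _ => ?_
    rw [mul_comm, Complex.star_def, Complex.mul_conj, Complex.normSq_eq_norm_sq, Complex.ofReal_re]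
  have hrow : ∀ m, ∑ i, ‖V m i‖ ^ 2 = 1 := by
    intro i
    have h := congrFun (congrFun hV i) i
    simp only [mul_apply, conjTranspose_apply, one_apply_eq] at h
    have h2 := congrArg Complex.re h
    simp only [Complex.re_sum, Complex.one_re] at h2
    rw [← h2]
    refine Finset.sum_congr rfl fun m _ => ?_
    rw [Complex.star_def, Complex.mul_conj, Complex.normSq_eq_norm_sq, Complex.ofReal_re]
  -- The squared moduli of the entries of `V` form a doubly stochastic matrix. Averaging the scalar
  -- Klein terms with these weights gives the gap between the two sides; the linear terms cancel
  -- because the traces agree.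
  set t : A → A → ℝ := fun m i =>
    ‖V m i‖ ^ 2 * (p i * Real.log (p i) - p i * Real.log (q m) - p i + q m) with ht
  have hwp : ∀ m, q m = 0 → ∀ i, ‖V m i‖ ^ 2 * p i = 0 := by
    intro m hm i
    have h := hz m hm
    rw [hdiag, Finset.sum_eq_zero_iff_of_nonneg
      fun i _ => mul_nonneg (sq_nonneg _) (hp i)] at h
    exact h i (Finset.mem_univ i)
  have ht0 : ∀ m i, 0 ≤ t m i := by
    intro m i
    rcases (hq m).eq_or_lt with h | h
    · have h2 := hwp m h.symm i
      rcases mul_eq_zero.1 h2 with h3 | h3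
      · simp [ht, h3]
      · simp [ht, h3, ← h]
    · exact mul_nonneg (sq_nonneg _) (klein_term_nonneg (hp i) h)
  -- A vanishing term forces `p i = q m` wherever `V m i` is nonzero. Over all entries this says
  -- that `V` intertwines the two diagonal matrices, which is the equality case.
  have ht1 : ∀ m i, t m i = 0 → V m i * p i = q m * V m i := by
    intro m i h0
    rcases mul_eq_zero.1 h0 with h3 | h3
    · have : V m i = 0 := by simpa using h3
      simp [this]
    rcases (hq m).eq_or_lt with h | h
    · have h2 := hwp m h.symm i
      rcases mul_eq_zero.1 h2 with h3 | h3
      · have : V m i = 0 := by simpa using h3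
        simp [this]
      · simp [h3, ← h]
    · rw [klein_term_eq_zero (hp i) h h3, mul_comm]
  have hS : entropy σ = ∑ i, Real.negMulLog (p i) := entropy_conj_diagonal hV'
  have hsum : ∑ m, ∑ i, t m i = -entropy σ - ∑ m, (σ m m).re * Real.log (q m) := by
    have e1 : ∑ m, ∑ i, ‖V m i‖ ^ 2 * (p i * Real.log (p i)) = -entropy σ := by
      rw [Finset.sum_comm, hS, ← Finset.sum_neg_distrib]
      refine Finset.sum_congr rfl fun i _ => ?_
      rw [← Finset.sum_mul, hcol, Real.negMulLog]
      ring
    have e2 : ∑ m, ∑ i, ‖V m i‖ ^ 2 * (p i * Real.log (q m)) =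
        ∑ m, (σ m m).re * Real.log (q m) := by
      refine Finset.sum_congr rfl fun m _ => ?_
      rw [hdiag, Finset.sum_mul]
      exact Finset.sum_congr rfl fun i _ => by ring
    have e3 : ∑ m, ∑ i, ‖V m i‖ ^ 2 * p i = ∑ m, q m := by
      rw [htr]
      exact Finset.sum_congr rfl fun m _ => (hdiag m).symm
    have e4 : ∑ m, ∑ i, ‖V m i‖ ^ 2 * q m = ∑ m, q m := by
      refine Finset.sum_congr rfl fun m _ => ?_
      rw [← Finset.sum_mul, hrow, one_mul]
    simp only [ht, mul_add, mul_sub, Finset.sum_add_distrib, Finset.sum_sub_distrib, e1, e2, e3, e4]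
    ring
  constructor
  · have : 0 ≤ ∑ m, ∑ i, t m i :=
      Finset.sum_nonneg fun m _ => Finset.sum_nonneg fun i _ => ht0 m i
    linarith
  · intro heq
    have h0 : ∑ m, ∑ i, t m i = 0 := by linarith
    have h1 : V * (diagonal fun a => (p a : ℂ)) = (diagonal fun a => (q a : ℂ)) * V := by
      ext m i
      rw [mul_diagonal, diagonal_mul]
      rw [Finset.sum_eq_zero_iff_of_nonneg
        fun m _ => Finset.sum_nonneg fun i _ => ht0 m i] at h0
      have h2 := h0 m (Finset.mem_univ m)
      rw [Finset.sum_eq_zero_iff_of_nonneg fun i _ => ht0 m i] at h2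
      exact ht1 m i (h2 i (Finset.mem_univ i))
    rw [hσdef, h1, Matrix.mul_assoc, hV, Matrix.mul_one]

/-! ### Density matrices -/

/-- A density matrix: positive semidefinite of trace one. -/
structure IsDensity {A : Type*} [Fintype A] (ρ : Matrix A A ℂ) : Prop where
  posSemidef : ρ.PosSemidef
  trace_eq : ρ.trace = 1

theorem IsDensity.sum_re {A : Type*} [Fintype A] {ρ : Matrix A A ℂ} (h : IsDensity ρ) :
    ∑ a, (ρ a a).re = 1 := by
  have := congrArg Complex.re h.trace_eq
  simpa [Matrix.trace] using this

theorem IsDensity.nonempty {A : Type*} [Fintype A] {ρ : Matrix A A ℂ} (h : IsDensity ρ) :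
    Nonempty A := by
  by_contra hA
  rw [not_nonempty_iff] at hA
  simpa [Matrix.trace] using h.trace_eq

/-- Klein's inequality against the uniform distribution. -/
theorem IsDensity.entropy_le_log_card {A : Type*} [Fintype A] [DecidableEq A] {ρ : Matrix A A ℂ}
    (h : IsDensity ρ) : entropy ρ ≤ Real.log (Fintype.card A) := by
  have hA := h.nonempty
  have hc : (0 : ℝ) < Fintype.card A := by exact_mod_cast Fintype.card_pos
  have := (klein h.posSemidef (q := fun _ => (Fintype.card A : ℝ)⁻¹) (fun _ => by positivity)
    (by simp [h.sum_re, hc.ne']) (fun m hm => by simp at hm)).1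
  rw [← Finset.sum_mul, h.sum_re, Real.log_inv] at this
  linarith

/-! ### Partial traces, product states and subadditivity -/

section PartialTrace

variable {A B : Type*} [Fintype A] [Fintype B]

omit [Fintype B] in
theorem trLeft_eq_trRight_swap (ρ : Matrix (A × B) (A × B) ℂ) :
    trLeft ρ = trRight (ρ.submatrix Prod.swap Prod.swap) := rfl

omit [Fintype A] in
theorem posSemidef_trRight {ρ : Matrix (A × B) (A × B) ℂ} (h : ρ.PosSemidef) :
    (trRight ρ).PosSemidef := by
  have : trRight ρ = ∑ b, ρ.submatrix (fun a => (a, b)) (fun a => (a, b)) := by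
    ext a a'
    simp [trRight, Matrix.sum_apply]
  rw [this]
  exact posSemidef_sum _ fun b _ => h.submatrix _

omit [Fintype B] in
theorem posSemidef_trLeft {ρ : Matrix (A × B) (A × B) ℂ} (h : ρ.PosSemidef) :
    (trLeft ρ).PosSemidef :=
  posSemidef_trRight (h.submatrix Prod.swap)

theorem trace_trRight (ρ : Matrix (A × B) (A × B) ℂ) : (trRight ρ).trace = ρ.trace := by
  simp [Matrix.trace, trRight, Fintype.sum_prod_type]

theorem trace_trLeft (ρ : Matrix (A × B) (A × B) ℂ) : (trLeft ρ).trace = ρ.trace := by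
  simp [Matrix.trace, trLeft, Fintype.sum_prod_type_right]

theorem IsDensity.trRight {ρ : Matrix (A × B) (A × B) ℂ} (h : IsDensity ρ) :
    IsDensity (trRight ρ) :=
  ⟨posSemidef_trRight h.1, (trace_trRight ρ).trans h.2⟩

theorem IsDensity.trLeft {ρ : Matrix (A × B) (A × B) ℂ} (h : IsDensity ρ) :
    IsDensity (trLeft ρ) :=
  ⟨posSemidef_trLeft h.1, (trace_trLeft ρ).trans h.2⟩

theorem IsDensity.submatrix_equiv {ρ : Matrix A A ℂ} (h : IsDensity ρ) (e : B ≃ A) :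
    IsDensity (ρ.submatrix e e) :=
  ⟨h.1.submatrix e, by
    rw [← h.2]
    exact Fintype.sum_equiv e _ _ fun _ => rfl⟩

variable [DecidableEq A] [DecidableEq B]

-- A unitary on the traced-out factor disappears by orthonormality of its rows.
omit [DecidableEq A] in
theorem trRight_conj_kronecker (ρ : Matrix (A × B) (A × B) ℂ) (U : Matrix A A ℂ)
    {V : Matrix B B ℂ} (hV : V * Vᴴ = 1) :
    trRight ((U ⊗ₖ V)ᴴ * ρ * (U ⊗ₖ V)) = Uᴴ * trRight ρ * U := by
  ext j j'
  have hV' : ∀ t t', ∑ k, star (V t k) * V t' k = if t' = t then 1 else 0 := by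
    intro t t'
    have h := congrFun (congrFun hV t') t
    rw [mul_apply, one_apply] at h
    rw [← h]
    exact Finset.sum_congr rfl fun k _ => by rw [conjTranspose_apply, mul_comm]
  calc trRight ((U ⊗ₖ V)ᴴ * ρ * (U ⊗ₖ V)) j j'
      = ∑ k, ∑ s', ∑ t', ∑ s, ∑ t,
          star (U s j) * ρ (s, t) (s', t') * U s' j' * (star (V t k) * V t' k) := by
        simp only [trRight, of_apply, mul_apply, Fintype.sum_prod_type, conjTranspose_apply,
          kronecker_apply, Finset.sum_mul, star_mul']
        refine Finset.sum_congr rfl fun k _ => Finset.sum_congr rfl fun s' _ =>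
          Finset.sum_congr rfl fun t' _ => Finset.sum_congr rfl fun s _ =>
          Finset.sum_congr rfl fun t _ => ?_
        ring
    _ = ∑ s', ∑ t', ∑ s, ∑ t, star (U s j) * ρ (s, t) (s', t') * U s' j' *
          ∑ k, (star (V t k) * V t' k) := by
        simp only [Finset.mul_sum]
        rw [Finset.sum_comm]
        refine Finset.sum_congr rfl fun s' _ => ?_
        rw [Finset.sum_comm]
        refine Finset.sum_congr rfl fun t' _ => ?_
        rw [Finset.sum_comm]
        refine Finset.sum_congr rfl fun s _ => ?_
        rw [Finset.sum_comm]
    _ = (Uᴴ * trRight ρ * U) j j' := by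
        simp only [hV', mul_ite, mul_one, mul_zero, Finset.sum_ite_eq, Finset.mem_univ, if_true]
        simp only [trRight, of_apply, mul_apply, conjTranspose_apply, Finset.mul_sum,
          Finset.sum_mul]
        refine Finset.sum_congr rfl fun s' _ => ?_
        rw [Finset.sum_comm]

omit [DecidableEq B] in
theorem trLeft_conj_kronecker (ρ : Matrix (A × B) (A × B) ℂ) {U : Matrix A A ℂ}
    (V : Matrix B B ℂ) (hU : U * Uᴴ = 1) :
    trLeft ((U ⊗ₖ V)ᴴ * ρ * (U ⊗ₖ V)) = Vᴴ * trLeft ρ * V := by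
  rw [trLeft_eq_trRight_swap, trLeft_eq_trRight_swap, ← trRight_conj_kronecker _ V hU]
  congr 1
  have h : (V ⊗ₖ U) = (U ⊗ₖ V).submatrix (Equiv.prodComm B A) (Equiv.prodComm B A) := by
    ext ⟨a, b⟩ ⟨a', b'⟩
    simp [mul_comm]
  rw [h]
  change Matrix.submatrix _ (Equiv.prodComm B A) (Equiv.prodComm B A) =
    _ * Matrix.submatrix _ (Equiv.prodComm B A) (Equiv.prodComm B A) * _
  rw [conjTranspose_submatrix, submatrix_mul_equiv, submatrix_mul_equiv]

theorem kronecker_conj_diagonal (U : Matrix A A ℂ) (V : Matrix B B ℂ) (a : A → ℝ) (b : B → ℝ) :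
    (U * (diagonal fun i => (a i : ℂ)) * Uᴴ) ⊗ₖ (V * (diagonal fun i => (b i : ℂ)) * Vᴴ) =
      (U ⊗ₖ V) * (diagonal fun i : A × B => ((a i.1 * b i.2 : ℝ) : ℂ)) * (U ⊗ₖ V)ᴴ := by
  rw [mul_kronecker_mul, mul_kronecker_mul, diagonal_kronecker_diagonal, conjTranspose_kronecker]
  simp

theorem sum_eq_one_of_conj_diagonal {U : Matrix A A ℂ} {a : A → ℝ} (hU : Uᴴ * U = 1)
    (h : IsDensity (U * (diagonal fun i => (a i : ℂ)) * Uᴴ)) : ∑ i, a i = 1 := by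
  have := h.2
  rw [Matrix.trace_mul_cycle, hU, Matrix.one_mul, trace_diagonal] at this
  exact_mod_cast this

theorem entropy_kronecker {α : Matrix A A ℂ} {β : Matrix B B ℂ} (hα : IsDensity α)
    (hβ : IsDensity β) : entropy (α ⊗ₖ β) = entropy α + entropy β := by
  obtain ⟨U, a, hU, hU', ha, rfl⟩ := exists_diagonalization hα.1
  obtain ⟨V, b, hV, hV', hb, rfl⟩ := exists_diagonalization hβ.1
  have h1 := sum_eq_one_of_conj_diagonal hU' hα
  have h2 := sum_eq_one_of_conj_diagonal hV' hβ
  rw [kronecker_conj_diagonal, entropy_conj_diagonal, entropy_conj_diagonal hU',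
    entropy_conj_diagonal hV']
  · simp only [Real.negMulLog_mul, Fintype.sum_prod_type, Finset.sum_add_distrib, ← Finset.sum_mul,
      ← Finset.mul_sum, h1, h2, one_mul]
  · rw [conjTranspose_kronecker, ← mul_kronecker_mul, hU', hV', one_kronecker_one]

/-- Subadditivity of the entropy, with its equality case. -/
theorem subadditivity {ρ : Matrix (A × B) (A × B) ℂ} (hρ : IsDensity ρ) :
    entropy ρ ≤ entropy (trRight ρ) + entropy (trLeft ρ) ∧
      (entropy ρ = entropy (trRight ρ) + entropy (trLeft ρ) →
        ρ = trRight ρ ⊗ₖ trLeft ρ) := by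
  obtain ⟨U, a, hU, hU', ha, hα⟩ := exists_diagonalization hρ.trRight.1
  obtain ⟨V, b, hV, hV', hb, hβ⟩ := exists_diagonalization hρ.trLeft.1
  have hsa := sum_eq_one_of_conj_diagonal hU' (hα ▸ hρ.trRight)
  have hsb := sum_eq_one_of_conj_diagonal hV' (hβ ▸ hρ.trLeft)
  have hSa : entropy (trRight ρ) = ∑ i, Real.negMulLog (a i) := by
    rw [hα, entropy_conj_diagonal hU']
  have hSb : entropy (trLeft ρ) = ∑ i, Real.negMulLog (b i) := by
    rw [hβ, entropy_conj_diagonal hV']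
  -- Conjugating by `W` makes both marginals diagonal without changing the entropy, so Klein's
  -- inequality can be applied to the product distribution of their eigenvalues.
  set W := U ⊗ₖ V with hWdef
  have hW : W * Wᴴ = 1 := by
    rw [hWdef, conjTranspose_kronecker, ← mul_kronecker_mul, hU, hV, one_kronecker_one]
  set σ := Wᴴ * ρ * W with hσdef
  have hσ : σ.PosSemidef := hρ.1.conjTranspose_mul_mul_same W
  have hr : trRight σ = diagonal fun i => (a i : ℂ) := by
    rw [hσdef, trRight_conj_kronecker _ _ hV, hα, Matrix.mul_assoc, Matrix.mul_assoc, hU',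
      Matrix.mul_one, ← Matrix.mul_assoc, hU', Matrix.one_mul]
  have hl : trLeft σ = diagonal fun i => (b i : ℂ) := by
    rw [hσdef, trLeft_conj_kronecker _ _ hU, hβ, Matrix.mul_assoc, Matrix.mul_assoc, hV',
      Matrix.mul_one, ← Matrix.mul_assoc, hV', Matrix.one_mul]
  have hra : ∀ i, ∑ j, (σ (i, j) (i, j)).re = a i := by
    intro i
    have := congrArg Complex.re (congrFun (congrFun hr i) i)
    simpa [trRight] using this
  have hlb : ∀ j, ∑ i, (σ (i, j) (i, j)).re = b j := by
    intro i
    have := congrArg Complex.re (congrFun (congrFun hl i) i)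
    simpa [trLeft] using this
  have hσ0 : ∀ m, 0 ≤ (σ m m).re := fun m => (Complex.le_def.1 hσ.diag_nonneg).1
  -- Support condition for Klein: a zero eigenvalue of a marginal is a vanishing sum of nonnegative
  -- diagonal entries, so each entry vanishes.
  have ha0 : ∀ i, a i = 0 → ∀ j, (σ (i, j) (i, j)).re = 0 := by
    intro i hi j
    have h := hra i
    rw [hi, Finset.sum_eq_zero_iff_of_nonneg fun j _ => hσ0 _] at h
    exact h j (Finset.mem_univ j)
  have hb0 : ∀ j, b j = 0 → ∀ i, (σ (i, j) (i, j)).re = 0 := by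
    intro j hj i
    have h := hlb j
    rw [hj, Finset.sum_eq_zero_iff_of_nonneg fun j _ => hσ0 _] at h
    exact h i (Finset.mem_univ i)
  have hS : entropy σ = entropy ρ := entropy_unitary_conj hρ.1.1 hW
  have hlog : -∑ m : A × B, (σ m m).re * Real.log (a m.1 * b m.2) =
      entropy (trRight ρ) + entropy (trLeft ρ) := by
    have : ∀ m : A × B, (σ m m).re * Real.log (a m.1 * b m.2) =
        (σ m m).re * Real.log (a m.1) + (σ m m).re * Real.log (b m.2) := by
      rintro ⟨i, j⟩
      by_cases h1 : a i = 0
      · simp [ha0 i h1 j]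
      by_cases h2 : b j = 0
      · simp [hb0 j h2 i]
      rw [Real.log_mul h1 h2, mul_add]
    rw [Finset.sum_congr rfl fun m _ => this m, Finset.sum_add_distrib, Fintype.sum_prod_type,
      Fintype.sum_prod_type_right, hSa, hSb]
    simp only [← Finset.sum_mul, hra, hlb, Real.negMulLog, neg_mul, Finset.sum_neg_distrib]
    ring
  have hk := klein hσ (q := fun m : A × B => a m.1 * b m.2)
    (fun m => mul_nonneg (ha _) (hb _))
    (by simp only [Fintype.sum_prod_type, ← Finset.mul_sum, hsb, hra]; simp)
    (fun m hm => by
      rcases mul_eq_zero.1 hm with h | h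
      · exact ha0 m.1 h m.2
      · exact hb0 m.2 h m.1)
  rw [hS, hlog] at hk
  refine ⟨hk.1, fun h => ?_⟩
  rw [hα, hβ, kronecker_conj_diagonal, ← hk.2 h, hσdef]
  rw [Matrix.mul_assoc, Matrix.mul_assoc, hW, Matrix.mul_one, ← Matrix.mul_assoc, hW,
    Matrix.one_mul]

theorem eq_kronecker_of_mutualInfo_eq_zero {ρ : Matrix (A × B) (A × B) ℂ} (hρ : IsDensity ρ)
    (h : mutualInfo ρ = 0) : ρ = trRight ρ ⊗ₖ trLeft ρ :=
  (subadditivity hρ).2 (by rw [mutualInfo] at h; linarith)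

theorem mutualInfo_eq_zero_of_eq_kronecker {ρ : Matrix (A × B) (A × B) ℂ} (hρ : IsDensity ρ)
    {α : Matrix A A ℂ} {β : Matrix B B ℂ} (h : ρ = α ⊗ₖ β) : mutualInfo ρ = 0 := by
  -- The factors need not be normalised; only the product of their traces is 1, and that is enough
  -- to replace them by the marginals.
  have hr : trRight ρ = β.trace • α := by
    ext i j
    simp [h, trRight, Matrix.trace, ← Finset.mul_sum, mul_comm]
  have hl : trLeft ρ = α.trace • β := by
    ext i j
    simp [h, trLeft, Matrix.trace, ← Finset.sum_mul]
  have ht : α.trace * β.trace = 1 := by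
    rw [← trace_kronecker, ← h, hρ.2]
  have h2 : ρ = trRight ρ ⊗ₖ trLeft ρ := by
    rw [hr, hl, smul_kronecker, kronecker_smul, smul_smul, mul_comm, ht, one_smul, h]
  have h3 := entropy_kronecker hρ.trRight hρ.trLeft
  rw [← h2] at h3
  rw [mutualInfo, h3, sub_self]

end PartialTrace

/-! ### Pure states and purification -/

/-- The two reduced states of a pure state have the same entropy. -/
theorem entropy_trRight_pureState {A B : Type*} [Fintype A] [DecidableEq A] [Fintype B]
    [DecidableEq B] (ψ : A × B → ℂ) :
    entropy (trRight (pureState ψ)) = entropy (trLeft (pureState ψ)) := by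
  -- With the amplitudes arranged as a matrix `C`, the reduced states are `C * Cᴴ` and the transpose
  -- of `Cᴴ * C`.
  set C : Matrix A B ℂ := of fun a b => ψ (a, b)
  have h1 : trRight (pureState ψ) = C * Cᴴ := by
    ext a a'
    simp [trRight, pureState, C, mul_apply, vecMulVec_apply]
  have h2 : trLeft (pureState ψ) = (Cᴴ * C)ᵀ := by
    ext a a'
    simp [trLeft, pureState, C, mul_apply, vecMulVec_apply, mul_comm]
  rw [h1, h2, entropy_transpose (isHermitian_conjTranspose_mul_self C),
    entropy_mul_conjTranspose_comm]

theorem isDensity_pureState {A : Type*} [Fintype A] {ψ : A → ℂ} (h : IsUnitVector ψ) :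
    IsDensity (pureState ψ) := by
  refine ⟨posSemidef_vecMulVec_self_star ψ, ?_⟩
  have : (pureState ψ).trace = ((∑ a, ‖ψ a‖ ^ 2 : ℝ) : ℂ) := by
    simp [pureState, Matrix.trace, vecMulVec_apply, Complex.mul_conj, Complex.normSq_eq_norm_sq]
  rw [this, h]
  simp

theorem entropy_pureState {A : Type*} [Fintype A] [DecidableEq A] {ψ : A → ℂ}
    (h : IsUnitVector ψ) : entropy (pureState ψ) = 0 := by
  -- Adjoining a one-dimensional system makes the pure state a marginal of a bipartite pure state
  -- whose other marginal is the scalar 1.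
  set φ : A × Unit → ℂ := fun x => ψ x.1
  have h1 : pureState ψ = trRight (pureState φ) := by
    ext a a'
    simp [trRight, pureState, φ, vecMulVec_apply]
  have h2 : trLeft (pureState φ) = diagonal fun _ => ((1 : ℝ) : ℂ) := by
    ext a a'
    have := (isDensity_pureState h).2
    simpa [trLeft, pureState, φ, vecMulVec_apply, Matrix.trace] using this
  rw [h1, entropy_trRight_pureState, h2, entropy_diagonal]
  simp

theorem mutualInfo_pureState {A B : Type*} [Fintype A] [DecidableEq A] [Fintype B]
    [DecidableEq B] {ψ : A × B → ℂ} (h : IsUnitVector ψ) :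
    mutualInfo (pureState ψ) = 2 * entropy (trLeft (pureState ψ)) := by
  rw [mutualInfo, entropy_pureState h, entropy_trRight_pureState]
  ring

/-- The triangle inequality of Araki and Lieb. -/
theorem entropy_trRight_le {A B : Type*} [Fintype A] [DecidableEq A] [Fintype B]
    [DecidableEq B] {ρ : Matrix (A × B) (A × B) ℂ} (hρ : IsDensity ρ) :
    entropy (trRight ρ) ≤ entropy ρ + entropy (trLeft ρ) := by
  obtain ⟨C, hC⟩ := exists_eq_mul_conjTranspose hρ.1
  -- The entries of `C` purify `ρ` with an environment E. The same vector is read as a state of AB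
  -- with E and as a state of A with BE, so S(A) = S(BE) ≤ S(B) + S(E) = S(B) + S(AB).
  set φ : (A × B) × (A × B) → ℂ := fun x => C x.1 x.2 with hφ
  set χ : A × (B × (A × B)) → ℂ := fun x => C (x.1, x.2.1) x.2.2 with hχ
  have e1 : trRight (pureState φ) = ρ := by
    rw [hC]
    ext a a'
    simp [trRight, pureState, φ, vecMulVec_apply, mul_apply]
  have e2 : trRight (pureState χ) = trRight ρ := by
    rw [hC]
    ext a a'
    simp [trRight, pureState, χ, vecMulVec_apply, mul_apply, Fintype.sum_prod_type]
  have e3 : trRight (trLeft (pureState χ)) = trLeft ρ := by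
    rw [hC]
    ext b b'
    simp only [trRight, trLeft, pureState, hχ, vecMulVec_apply, mul_apply, of_apply,
      conjTranspose_apply, Pi.star_apply]
    rw [Finset.sum_comm]
  have e4 : trLeft (trLeft (pureState χ)) = trLeft (pureState φ) := by
    ext b b'
    simp only [trLeft, pureState, hχ, hφ, vecMulVec_apply, of_apply,
      Pi.star_apply, Fintype.sum_prod_type]
    rw [Finset.sum_comm]
  have hd : IsDensity (pureState χ) :=
    ⟨posSemidef_vecMulVec_self_star χ, by rw [← trace_trRight, e2, trace_trRight, hρ.2]⟩
  have h := (subadditivity hd.trLeft).1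
  rw [← entropy_trRight_pureState, e2, e3, e4, ← entropy_trRight_pureState, e1] at h
  linarith

/-! ### Marginals along a map -/

open Classical in
/-- The marginal of `X` along `f`, where the indices related by `E` are the ones traced over. All
partial traces are of this form. -/
noncomputable def marg {T A : Type*} [Fintype T] (f : T → A) (E : T → T → Prop)
    (X : Matrix T T ℂ) : Matrix A A ℂ :=
  of fun a a' => ∑ t, ∑ t', if f t = a ∧ f t' = a' ∧ E t t' then X t t' else 0

section Marg

variable {T A B : Type*} [Fintype T]

theorem marg_congr {f : T → A} {E E' : T → T → Prop} (h : ∀ t t', E t t' ↔ E' t t')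
    (X : Matrix T T ℂ) : marg f E X = marg f E' X := by
  have : E = E' := by
    ext t t'
    exact h t t'
  rw [this]

open Classical in
theorem marg_apply_eq {f : T → A} {g : T → B} {E E' : T → T → Prop} {a a' : A} {b b' : B}
    (h : ∀ t t', (f t = a ∧ f t' = a' ∧ E t t') ↔ (g t = b ∧ g t' = b' ∧ E' t t'))
    (X : Matrix T T ℂ) : marg f E X a a' = marg g E' X b b' := by
  simp only [marg, of_apply, h]

/-- Successive partial traces compose by conjunction of their relations. Equalities between iterated
reductions therefore become elementary equivalences, settled through `marg_congr`. -/
theorem marg_marg [Fintype A] (f' : A → B) (E' : A → A → Prop) (f : T → A) (E : T → T → Prop)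
    (X : Matrix T T ℂ) :
    marg f' E' (marg f E X) = marg (f' ∘ f) (fun t t' => E' (f t) (f t') ∧ E t t') X := by
  classical
  ext b b'
  simp only [marg, of_apply, Function.comp_apply]
  calc _ = ∑ a, ∑ a', ∑ t, ∑ t', if (f t = a ∧ f t' = a') then
          (if f' a = b ∧ f' a' = b' ∧ E' a a' ∧ E t t' then X t t' else 0) else 0 := by
        refine Finset.sum_congr rfl fun a _ => Finset.sum_congr rfl fun a' _ => ?_
        by_cases h : f' a = b ∧ f' a' = b' ∧ E' a a'
        · rw [if_pos h]
          refine Finset.sum_congr rfl fun t _ => Finset.sum_congr rfl fun t' _ => ?_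
          simp [h, ← and_assoc, ite_and]
        · rw [if_neg h]
          symm
          refine Finset.sum_eq_zero fun t _ => Finset.sum_eq_zero fun t' _ => ?_
          have h' : ¬(f' a = b ∧ f' a' = b' ∧ E' a a' ∧ E t t') :=
            fun h2 => h ⟨h2.1, h2.2.1, h2.2.2.1⟩
          rw [if_neg h', ite_self]
    _ = ∑ t, ∑ t', ∑ a, ∑ a', if (f t = a ∧ f t' = a') then
          (if f' a = b ∧ f' a' = b' ∧ E' a a' ∧ E t t' then X t t' else 0) else 0 := by
        rw [Finset.sum_congr rfl fun a _ => Finset.sum_comm, Finset.sum_comm]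
        refine Finset.sum_congr rfl fun t _ => ?_
        rw [Finset.sum_congr rfl fun a _ => Finset.sum_comm, Finset.sum_comm]
    _ = _ := by
        refine Finset.sum_congr rfl fun t _ => Finset.sum_congr rfl fun t' _ => ?_
        by_cases h : E' (f t) (f t') <;> simp [ite_and, h]

theorem marg_equiv_comp (e : A ≃ B) (f : T → A) (E : T → T → Prop) (X : Matrix T T ℂ) :
    marg (e ∘ f) E X = (marg f E X).submatrix e.symm e.symm := by
  ext b b'
  exact marg_apply_eq (fun t t' => by simp [Equiv.eq_symm_apply]) X

theorem marg_id (X : Matrix T T ℂ) : marg id (fun _ _ => True) X = X := by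
  classical
  ext a a'
  simp [marg, ite_and]

theorem trRight_eq_marg [Fintype A] [Fintype B] (ρ : Matrix (A × B) (A × B) ℂ) :
    trRight ρ = marg Prod.fst (fun t t' => t.2 = t'.2) ρ := by
  classical
  ext a a'
  simp only [trRight, marg, of_apply, Fintype.sum_prod_type]
  simp only [ite_and, Finset.sum_ite_irrel, Finset.sum_const_zero, Finset.sum_ite_eq',
    Finset.mem_univ, if_true]
  refine Finset.sum_congr rfl fun b _ => ?_
  rw [Finset.sum_comm]
  simp

theorem trLeft_eq_marg [Fintype A] [Fintype B] (ρ : Matrix (A × B) (A × B) ℂ) :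
    trLeft ρ = marg Prod.snd (fun t t' => t.1 = t'.1) ρ := by
  classical
  ext a a'
  simp only [trLeft, marg, of_apply, Fintype.sum_prod_type_right]
  simp only [ite_and, Finset.sum_ite_irrel, Finset.sum_const_zero, Finset.sum_ite_eq',
    Finset.mem_univ, if_true]
  refine Finset.sum_congr rfl fun b _ => ?_
  rw [Finset.sum_comm]
  simp

theorem reindex_eq_marg [Fintype A] (e : T ≃ A) (X : Matrix T T ℂ) :
    reindex e e X = marg e (fun _ _ => True) X := by
  have := marg_equiv_comp e id (fun _ _ => True) X
  rw [marg_id] at this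
  exact this.symm

theorem reduceTo_eq_marg {ι : Type*} [Fintype ι] [DecidableEq ι] {A : ι → Type*}
    [∀ i, Fintype (A i)] {R : Type*} [Fintype R] (S : Finset ι)
    (X : Matrix (R × ∀ i, A i) (R × ∀ i, A i) ℂ) :
    reduceTo S X = marg (fun t => (t.1, fun i : {i // i ∈ S} => t.2 i))
      (fun t t' => ∀ i, i ∉ S → t.2 i = t'.2 i) X := by
  rw [reduceTo, trRight_eq_marg, reindex_eq_marg, marg_marg]
  exact marg_congr (fun t t' => by simp [funext_iff]) X

theorem reduceToSingle_eq_marg {ι : Type*} [Fintype ι] [DecidableEq ι] {A : ι → Type*}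
    [∀ i, Fintype (A i)] (j : ι) (X : Matrix (∀ i, A i) (∀ i, A i) ℂ) :
    reduceToSingle j X = marg (fun t => t j) (fun t t' => ∀ i, i ≠ j → t i = t' i) X := by
  rw [reduceToSingle, trRight_eq_marg, reindex_eq_marg, marg_marg]
  exact marg_congr (fun t t' => by simp [funext_iff]) X

/-- Here `g` labels the traced-out part. Each value of `g` contributes one congruence of `X`, which
gives positivity; joint injectivity of `f` and `g` leaves only the diagonal of `X` in the trace. -/
theorem isDensity_marg [Fintype A] {X : Matrix T T ℂ} (hX : IsDensity X) {f : T → A}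
    {E : T → T → Prop} (g : T → B) (hE : ∀ t t', E t t' ↔ g t = g t')
    (hfg : ∀ t t', f t = f t' → g t = g t' → t = t') : IsDensity (marg f E X) := by
  classical
  constructor
  · have : marg f E X = ∑ b ∈ Finset.univ.image g,
        (of fun a t => if f t = a ∧ g t = b then (1 : ℂ) else 0) * X *
          (of fun a t => if f t = a ∧ g t = b then (1 : ℂ) else 0)ᴴ := by
      ext a a'
      simp only [marg, of_apply, Matrix.sum_apply, mul_apply, conjTranspose_apply,
        Finset.sum_mul]
      rw [Finset.sum_comm, Finset.sum_comm (s := Finset.univ.image g)]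
      refine Finset.sum_congr rfl fun t' _ => ?_
      rw [Finset.sum_comm]
      refine Finset.sum_congr rfl fun t _ => ?_
      rw [Finset.sum_eq_single (g t)]
      · simp only [hE, eq_comm (a := g t)]
        by_cases h1 : f t = a <;> by_cases h2 : f t' = a' <;> by_cases h3 : g t' = g t <;>
          simp [h1, h2, h3]
      · intro b _ hb
        simp [hb.symm]
      · intro h
        exact absurd (Finset.mem_image_of_mem g (Finset.mem_univ t)) h
    rw [this]
    exact posSemidef_sum _ fun b _ => hX.1.mul_mul_conjTranspose_same _
  · rw [← hX.2]
    simp only [Matrix.trace, diag_apply, marg, of_apply]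
    rw [Finset.sum_comm]
    refine Finset.sum_congr rfl fun t _ => ?_
    rw [Finset.sum_comm, Finset.sum_eq_single t]
    · simp [hE]
    · intro t' _ hne
      refine Finset.sum_eq_zero fun a _ => ?_
      rw [if_neg]
      rintro ⟨h1, h2, h3⟩
      exact hne (hfg t t' (h1.trans h2.symm) ((hE t t').1 h3)).symm
    · simp

variable [Fintype A] [DecidableEq A] [Fintype B] [DecidableEq B]

theorem entropy_marg_equiv_comp {E : T → T → Prop} {f : T → A} {X : Matrix T T ℂ}
    (h : IsDensity (marg f E X)) (e : A ≃ B) :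
    entropy (marg (e ∘ f) E X) = entropy (marg f E X) := by
  rw [marg_equiv_comp, entropy_submatrix_equiv h.1.1]

theorem entropy_marg_pair_le {E : T → T → Prop} {f : T → A} {g : T → B} {X : Matrix T T ℂ}
    (h : IsDensity (marg (fun t => (f t, g t)) E X)) :
    entropy (marg (fun t => (f t, g t)) E X) ≤
      entropy (marg f (fun t t' => g t = g t' ∧ E t t') X) +
        entropy (marg g (fun t t' => f t = f t' ∧ E t t') X) := by
  have := (subadditivity h).1
  rwa [trRight_eq_marg, trLeft_eq_marg, marg_marg, marg_marg] at this

theorem entropy_marg_fst_le {E : T → T → Prop} {f : T → A} {g : T → B} {X : Matrix T T ℂ}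
    (h : IsDensity (marg (fun t => (f t, g t)) E X)) :
    entropy (marg f (fun t t' => g t = g t' ∧ E t t') X) ≤
      entropy (marg (fun t => (f t, g t)) E X) +
        entropy (marg g (fun t t' => f t = f t' ∧ E t t') X) := by
  have := entropy_trRight_le h
  rwa [trRight_eq_marg, trLeft_eq_marg, marg_marg, marg_marg] at this

end Marg

/-! ### Entropies of subsystems -/

section Subsystems

variable {ι : Type*} [Fintype ι] [DecidableEq ι] {A : ι → Type*} [∀ i, Fintype (A i)]
  [∀ i, DecidableEq (A i)]

/-- The reduced state of the systems in `S`, for a state of a family of systems. -/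
noncomputable def margPi (S : Finset ι) (X : Matrix (∀ i, A i) (∀ i, A i) ℂ) :
    Matrix (∀ i : {i // i ∈ S}, A i) (∀ i : {i // i ∈ S}, A i) ℂ :=
  marg (fun t i => t i) (fun t t' => ∀ i, i ∉ S → t i = t' i) X

omit [∀ i, DecidableEq (A i)] in
theorem isDensity_margPi {X : Matrix (∀ i, A i) (∀ i, A i) ℂ} (hX : IsDensity X)
    (S : Finset ι) : IsDensity (margPi S X) := by
  refine isDensity_marg hX (fun t (i : {i // i ∉ S}) => t i) (fun t t' => ?_) (fun t t' h1 h2 => ?_)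
  · simp [funext_iff]
  · ext i
    by_cases h : i ∈ S
    · exact congrFun h1 ⟨i, h⟩
    · exact congrFun h2 ⟨i, h⟩

theorem entropy_margPi_insert_le {X : Matrix (∀ i, A i) (∀ i, A i) ℂ} (hX : IsDensity X)
    {S : Finset ι} {j : ι} (hj : j ∉ S) :
    entropy (margPi (insert j S) X) ≤ entropy (margPi S X) + entropy (reduceToSingle j X) := by
  have hd := isDensity_margPi hX (insert j S)
  -- Splits off the coordinate `j`, so that bipartite subadditivity applies.
  let F : (∀ i : {i // i ∈ insert j S}, A i) → (∀ i : {i // i ∈ S}, A i) × A j :=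
    fun x => (fun i => x ⟨i, Finset.mem_insert_of_mem i.2⟩, x ⟨j, Finset.mem_insert_self j S⟩)
  have hF : Function.Bijective F := by
    constructor
    · intro x y h
      obtain ⟨h1, h2⟩ := Prod.ext_iff.1 h
      ext ⟨i, hi⟩
      by_cases hij : i = j
      · subst hij
        exact h2
      · exact congrFun h1 ⟨i, Finset.mem_of_mem_insert_of_ne hi hij⟩
    · rintro ⟨u, b⟩
      refine ⟨fun i => if h : i.1 = j then cast (congrArg A h.symm) b else
        u ⟨i.1, Finset.mem_of_mem_insert_of_ne i.2 h⟩, Prod.ext ?_ ?_⟩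
      · funext i
        have : i.1 ≠ j := fun h => hj (h ▸ i.2)
        simp [F, this]
      · simp [F]
  have h1 := entropy_marg_equiv_comp hd (Equiv.ofBijective F hF)
  have h2 : IsDensity (marg (Equiv.ofBijective F hF ∘ fun t (i : {i // i ∈ insert j S}) => t i)
      (fun t t' => ∀ i, i ∉ insert j S → t i = t' i) X) := by
    rw [marg_equiv_comp]
    exact hd.submatrix_equiv _
  have h3 := entropy_marg_pair_le (f := fun (t : ∀ i, A i) (i : {i // i ∈ S}) => t i)
    (g := fun t => t j) h2
  refine (h1.symm.le.trans h3).trans_eq ?_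
  rw [reduceToSingle_eq_marg, margPi]
  congr 2
  · refine marg_congr (fun t t' => ⟨fun h i hi => ?_, fun h => ⟨h j hj, fun i hi => h i ?_⟩⟩) X
    · by_cases hij : i = j
      · subst hij
        exact h.1
      · exact h.2 i (by simp [hij, hi])
    · exact fun h => hi (Finset.mem_insert_of_mem h)
  · refine marg_congr (fun t t' => ⟨fun h i hi => ?_, fun h => ⟨?_, fun i hi => h i ?_⟩⟩) X
    · by_cases hS : i ∈ S
      · exact congrFun h.1 ⟨i, hS⟩
      · exact h.2 i (by simp [hi, hS])
    · funext i
      exact h i fun hij => hj (hij ▸ i.2)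
    · rintro rfl
      exact hi (Finset.mem_insert_self _ _)

theorem entropy_margPi_le_sum {X : Matrix (∀ i, A i) (∀ i, A i) ℂ} (hX : IsDensity X)
    (S : Finset ι) : entropy (margPi S X) ≤ ∑ j ∈ S, entropy (reduceToSingle j X) := by
  induction S using Finset.induction_on with
  -- The empty family indexes a one-dimensional space, so its entropy is at most `log 1 = 0`.
  | empty => simpa using (isDensity_margPi hX ∅).entropy_le_log_card
  | insert j S hj ih =>
    rw [Finset.sum_insert hj]
    linarith [entropy_margPi_insert_le hX hj]

omit [∀ i, Fintype (A i)] [∀ i, DecidableEq (A i)] in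
theorem bijective_restrict_compl (S : Finset ι) : Function.Bijective fun x : ∀ i, A i =>
    ((fun i => x i : ∀ i : {i // i ∈ S}, A i), (fun i => x i : ∀ i : {i // i ∈ Sᶜ}, A i)) := by
  constructor
  · intro x y h
    obtain ⟨h1, h2⟩ := Prod.ext_iff.1 h
    ext i
    by_cases hi : i ∈ S
    · exact congrFun h1 ⟨i, hi⟩
    · exact congrFun h2 ⟨i, Finset.mem_compl.2 hi⟩
  · rintro ⟨u, v⟩
    refine ⟨fun i => if h : i ∈ S then u ⟨i, h⟩ else v ⟨i, Finset.mem_compl.2 h⟩,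
      Prod.ext ?_ ?_⟩
    · funext i
      simp
    · funext i
      have := Finset.mem_compl.1 i.2
      simp [this]

theorem entropy_le_margPi_add_compl {X : Matrix (∀ i, A i) (∀ i, A i) ℂ} (hX : IsDensity X)
    (S : Finset ι) : entropy X ≤ entropy (margPi S X) + entropy (margPi Sᶜ X) := by
  have hd : IsDensity (marg id (fun _ _ => True) X) := by rwa [marg_id]
  have h1 := entropy_marg_equiv_comp hd (Equiv.ofBijective _ (bijective_restrict_compl S))
  have h2 : IsDensity (marg (Equiv.ofBijective _ (bijective_restrict_compl S) ∘ id)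
      (fun _ _ => True) X) := by
    rw [marg_equiv_comp]
    exact hd.submatrix_equiv _
  have h3 := entropy_marg_pair_le (f := fun (t : ∀ i, A i) (i : {i // i ∈ S}) => t i)
    (g := fun (t : ∀ i, A i) (i : {i // i ∈ Sᶜ}) => t i) h2
  rw [marg_id] at h1
  refine (h1.symm.le.trans h3).trans_eq ?_
  rw [margPi, margPi]
  congr 2 <;> exact marg_congr (fun t t' => by simp [funext_iff]) X

variable {R : Type*} [Fintype R] [DecidableEq R]

omit [∀ i, DecidableEq (A i)] [DecidableEq R] in
theorem isDensity_reduceTo {Y : Matrix (R × ∀ i, A i) (R × ∀ i, A i) ℂ} (hY : IsDensity Y)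
    (S : Finset ι) : IsDensity (reduceTo S Y) :=
  (hY.submatrix_equiv _).trRight

omit [∀ i, DecidableEq (A i)] [DecidableEq R] in
theorem trLeft_reduceTo (Y : Matrix (R × ∀ i, A i) (R × ∀ i, A i) ℂ) (S : Finset ι) :
    trLeft (reduceTo S Y) = margPi S (trLeft Y) := by
  rw [reduceTo_eq_marg, margPi, trLeft_eq_marg, trLeft_eq_marg, marg_marg, marg_marg]
  exact marg_congr (fun t t' => by simp [and_comm]) Y

omit [∀ i, DecidableEq (A i)] [DecidableEq R] in
theorem trRight_reduceTo (Y : Matrix (R × ∀ i, A i) (R × ∀ i, A i) ℂ) (S : Finset ι) :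
    trRight (reduceTo S Y) = trRight Y := by
  rw [reduceTo_eq_marg, trRight_eq_marg, trRight_eq_marg, marg_marg]
  refine marg_congr (fun t t' => ?_) Y
  simp only [funext_iff]
  refine ⟨fun h i => ?_, fun h => ⟨fun i => h i, fun i _ => h i⟩⟩
  by_cases hi : i ∈ S
  · exact h.1 ⟨i, hi⟩
  · exact h.2 i hi

/-- The Araki-Lieb inequality for the cut that keeps `R` together with `S` and puts `Sᶜ` on the
other side. -/
theorem entropy_reduceTo_le {Y : Matrix (R × ∀ i, A i) (R × ∀ i, A i) ℂ} (hY : IsDensity Y)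
    (S : Finset ι) :
    entropy (reduceTo S Y) ≤ entropy Y + entropy (margPi Sᶜ (trLeft Y)) := by
  have hd : IsDensity (marg id (fun _ _ => True) Y) := by rwa [marg_id]
  let e : (R × ∀ i, A i) ≃ (R × ∀ i : {i // i ∈ S}, A i) × ∀ i : {i // i ∈ Sᶜ}, A i :=
    ((Equiv.refl R).prodCongr (Equiv.ofBijective _ (bijective_restrict_compl S))).trans
      (Equiv.prodAssoc _ _ _).symm
  have h1 := entropy_marg_equiv_comp hd e
  have h2 : IsDensity (marg (e ∘ id) (fun _ _ => True) Y) := by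
    rw [marg_equiv_comp]
    exact hd.submatrix_equiv _
  have h3 := entropy_marg_fst_le
    (f := fun (t : R × ∀ i, A i) => (t.1, fun i : {i // i ∈ S} => t.2 i))
    (g := fun (t : R × ∀ i, A i) (i : {i // i ∈ Sᶜ}) => t.2 i) h2
  rw [marg_id] at h1
  change _ ≤ entropy (marg (e ∘ id) _ Y) + _ at h3
  have e1 : reduceTo S Y = marg (fun t => (t.1, fun i : {i // i ∈ S} => t.2 i))
      (fun t t' => ((fun i : {i // i ∈ Sᶜ} => t.2 i) = fun i => t'.2 i) ∧ True) Y := by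
    rw [reduceTo_eq_marg]
    exact marg_congr (fun t t' => by simp [funext_iff]) Y
  have e2 : margPi Sᶜ (trLeft Y) = marg (fun t (i : {i // i ∈ Sᶜ}) => t.2 i)
      (fun t t' => ((t.1, fun i : {i // i ∈ S} => t.2 i) = (t'.1, fun i => t'.2 i)) ∧ True) Y := by
    rw [margPi, trLeft_eq_marg, marg_marg]
    exact marg_congr (fun t t' => by simp [funext_iff, and_comm]) Y
  rw [e1, e2, ← h1]
  exact h3

end Subsystems

/-! ### Quantum operations -/

theorem linearMap_apply_eq_sum {A B : Type*} [Fintype A] [DecidableEq A]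
    (Φ : Matrix A A ℂ →ₗ[ℂ] Matrix B B ℂ) (X : Matrix A A ℂ) (y y' : B) :
    Φ X y y' = ∑ x, ∑ x', X x x' * Φ (Matrix.single x x' 1) y y' := by
  conv_lhs => rw [matrix_eq_sum_single X]
  simp only [map_sum, Matrix.sum_apply]
  refine Finset.sum_congr rfl fun x _ => Finset.sum_congr rfl fun x' _ => ?_
  have : Matrix.single x x' (X x x') = X x x' • Matrix.single x x' (1 : ℂ) := by
    simp [Matrix.smul_single]
  rw [this, map_smul, Matrix.smul_apply, smul_eq_mul]

theorem QuantumOp.sum_map_single {A B : Type*} [Fintype A] [DecidableEq A] [Fintype B]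
    (Φ : QuantumOp A B) (x x' : A) :
    ∑ y, Φ.map (Matrix.single x x' 1) y y = if x = x' then 1 else 0 := by
  have h := Φ.trace_map (Matrix.single x x' 1)
  rw [Matrix.trace] at h
  refine h.trans ?_
  split_ifs with hx
  · subst hx
    simp
  · exact Matrix.trace_single_eq_of_ne _ _ _ hx

/-- Kraus decomposition of the entries of a quantum operation. -/
theorem QuantumOp.exists_kraus {a : ℕ} {B : Type*} [Fintype B] [DecidableEq B]
    (Φ : QuantumOp (Fin a) B) : ∃ K : Fin a × B → Fin a → B → ℂ, ∀ x x' y y',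
      Φ.map (Matrix.single x x' 1) y y' = ∑ k, K k x y * star (K k x' y') := by
  -- The Choi matrix: the operation acts on half of an unnormalised maximally entangled vector.
  -- Positivity factors the result as `C * Cᴴ`, and the columns of `C` are the Kraus operators.
  have h := Φ.completely_positive a
    (pureState fun p : Fin a × Fin a => if p.1 = p.2 then (1 : ℂ) else 0)
    (posSemidef_vecMulVec_self_star _)
  obtain ⟨C, hC⟩ := exists_eq_mul_conjTranspose h
  refine ⟨fun k x y => C (x, y) k, fun x x' y y' => ?_⟩
  have h2 := congrFun (congrFun hC (x, y)) (x', y')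
  rw [mul_apply] at h2
  rw [← Finset.sum_congr rfl fun k _ => by rw [← conjTranspose_apply], ← h2, idTensor, of_apply]
  refine congrArg (fun M => Φ.map M y y') ?_
  ext z z'
  by_cases hx : x = z <;> simp [pureState, vecMulVec_apply, Matrix.single_apply, hx]

section Pi

variable {ι : Type*} [Fintype ι] [DecidableEq ι] {R : Type*}

/-- Kraus operators of the tensor product are the products of one Kraus operator per factor,
tensored with the identity on `R`; they are indexed by the choice functions `k`. -/
theorem posSemidef_idTensorPi_of_kraus [Fintype R] [DecidableEq R] {A B κ : ι → Type*}
    [∀ i, Fintype (A i)] [∀ i, DecidableEq (A i)] [∀ i, Fintype (B i)] [∀ i, Fintype (κ i)]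
    {Φ : ∀ i, Matrix (A i) (A i) ℂ →ₗ[ℂ] Matrix (B i) (B i) ℂ} (K : ∀ i, κ i → A i → B i → ℂ)
    (hK : ∀ i x x' y y', Φ i (Matrix.single x x' 1) y y' = ∑ k, K i k x y * star (K i k x' y'))
    {X : Matrix (R × ∀ i, A i) (R × ∀ i, A i) ℂ} (hX : X.PosSemidef) :
    (idTensorPi R Φ X).PosSemidef := by
  let G : (∀ i, κ i) → Matrix (R × ∀ i, B i) (R × ∀ i, A i) ℂ := fun k =>
    of fun p q => if p.1 = q.1 then ∏ i, K i (k i) (q.2 i) (p.2 i) else 0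
  have : idTensorPi R Φ X = ∑ k, G k * X * (G k)ᴴ := by
    ext ⟨r, y⟩ ⟨r', y'⟩
    simp only [G, Matrix.sum_apply, mul_apply, conjTranspose_apply, of_apply, idTensorPi,
      Fintype.sum_prod_type, ite_mul, zero_mul, Finset.sum_ite_irrel, Finset.sum_const_zero,
      Finset.sum_ite_eq, Finset.mem_univ, if_true, apply_ite star, star_zero, mul_ite, mul_zero,
      hK, star_prod]
    simp only [Finset.prod_univ_sum, Fintype.piFinset_univ, Finset.mul_sum, Finset.sum_mul,
      Finset.prod_mul_distrib]
    rw [Finset.sum_comm]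
    conv_lhs =>
      enter [2, x']
      rw [Finset.sum_comm]
    rw [Finset.sum_comm]
    refine Finset.sum_congr rfl fun k _ => Finset.sum_congr rfl fun x' _ =>
      Finset.sum_congr rfl fun x _ => ?_
    ring
  rw [this]
  exact posSemidef_sum _ fun k _ => hX.mul_mul_conjTranspose_same _

theorem posSemidef_idTensorPi [Fintype R] [DecidableEq R] {a : ι → ℕ} {B : ι → Type*}
    [∀ i, Fintype (B i)] [∀ i, DecidableEq (B i)] (Φ : ∀ i, QuantumOp (Fin (a i)) (B i))
    {X : Matrix (R × ∀ i, Fin (a i)) (R × ∀ i, Fin (a i)) ℂ} (hX : X.PosSemidef) :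
    (idTensorPi R (fun i => (Φ i).map) X).PosSemidef := by
  choose K hK using fun i => (Φ i).exists_kraus
  exact posSemidef_idTensorPi_of_kraus K hK hX

variable {A B : ι → Type*} [∀ i, Fintype (A i)] [∀ i, DecidableEq (A i)] [∀ i, Fintype (B i)]

theorem sum_prod_map_single (Φ : ∀ i, QuantumOp (A i) (B i)) (x x' : ∀ i, A i) :
    ∑ y : ∀ i, B i, ∏ i, (Φ i).map (Matrix.single (x i) (x' i) 1) (y i) (y i) =
      if x = x' then 1 else 0 := by
  have h := Finset.prod_univ_sum (fun i => (Finset.univ : Finset (B i)))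
    (fun i y => (Φ i).map (Matrix.single (x i) (x' i) 1) y y)
  rw [Fintype.piFinset_univ] at h
  rw [← h]
  simp only [QuantumOp.sum_map_single, Finset.prod_ite_zero, Finset.prod_const_one, funext_iff,
    Finset.mem_univ, true_imp_iff]

theorem trRight_idTensorPi (Φ : ∀ i, QuantumOp (A i) (B i))
    (X : Matrix (R × ∀ i, A i) (R × ∀ i, A i) ℂ) :
    trRight (idTensorPi R (fun i => (Φ i).map) X) = trRight X := by
  ext r r'
  simp only [trRight, idTensorPi, of_apply]
  rw [Finset.sum_comm]
  refine Finset.sum_congr rfl fun x _ => ?_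
  rw [Finset.sum_comm]
  simp [← Finset.mul_sum, sum_prod_map_single]

/-- Tracing out one tensor factor of the image under a map whose coefficients factor, when the
coefficients of the traced-out factor are trace preserving. -/
theorem sum_coeff_factor {W U V Q : Type*} [Fintype W] [Fintype U] [Fintype V] [DecidableEq V]
    [Fintype Q] (e : U × V ≃ W) (X : W → W → ℂ) (c : W → W → Q → ℂ) (c₁ : U → U → ℂ)
    (c₂ : V → V → Q → ℂ)
    (hc : ∀ u u' v v' q, c (e (u, v)) (e (u', v')) q = c₁ u u' * c₂ v v' q)
    (h₂ : ∀ v v', ∑ q, c₂ v v' q = if v = v' then 1 else 0) :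
    ∑ q, ∑ w, ∑ w', X w w' * c w w' q =
      ∑ u, ∑ u', (∑ v, X (e (u, v)) (e (u', v))) * c₁ u u' := by
  calc ∑ q, ∑ w, ∑ w', X w w' * c w w' q
      = ∑ w, ∑ w', X w w' * ∑ q, c w w' q := by
        rw [Finset.sum_comm]
        refine Finset.sum_congr rfl fun w _ => ?_
        rw [Finset.sum_comm]
        simp only [Finset.mul_sum]
    _ = ∑ u, ∑ v, ∑ u', ∑ v', X (e (u, v)) (e (u', v')) *
          (c₁ u u' * if v = v' then 1 else 0) := by
        simp only [← e.sum_comp, Fintype.sum_prod_type, hc, ← Finset.mul_sum, h₂]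
    _ = _ := by
        refine Finset.sum_congr rfl fun u _ => ?_
        rw [Finset.sum_comm]
        refine Finset.sum_congr rfl fun u' _ => ?_
        rw [Finset.sum_mul]
        refine Finset.sum_congr rfl fun v _ => ?_
        simp

/-- Operations on traced-out systems have no effect since they preserve the trace; on matrix units
this is `sum_prod_map_single`. -/
theorem reduceTo_idTensorPi (Φ : ∀ i, QuantumOp (A i) (B i)) (S : Finset ι)
    (X : Matrix (R × ∀ i, A i) (R × ∀ i, A i) ℂ) :
    reduceTo S (idTensorPi R (fun i => (Φ i).map) X) =
      idTensorPi R (fun i : {i // i ∈ S} => (Φ i).map) (reduceTo S X) := by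
  ext ⟨r, y⟩ ⟨r', y'⟩
  have h := sum_coeff_factor (Equiv.piEquivPiSubtypeProd (fun i => i ∈ S) A).symm
    (fun x x' => X (r, x) (r', x'))
    (fun x x' (z : ∀ i : {i // ¬ i ∈ S}, B i) => ∏ i, (Φ i).map (Matrix.single (x i) (x' i) 1)
      ((Equiv.piEquivPiSubtypeProd (fun i => i ∈ S) B).symm (y, z) i)
      ((Equiv.piEquivPiSubtypeProd (fun i => i ∈ S) B).symm (y', z) i))
    (fun u u' => ∏ i : {i // i ∈ S}, (Φ i).map (Matrix.single (u i) (u' i) 1) (y i) (y' i))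
    (fun v v' z => ∏ i : {i // ¬ i ∈ S}, (Φ i).map (Matrix.single (v i) (v' i) 1) (z i) (z i))
    (fun u u' v v' z => by
      rw [← Fintype.prod_subtype_mul_prod_subtype (fun i => i ∈ S)]
      congr 1
      · refine Finset.prod_congr (by ext; simp) fun i _ => ?_
        simp [Equiv.piEquivPiSubtypeProd, i.2]
      · refine Finset.prod_congr rfl fun i _ => ?_
        simp [Equiv.piEquivPiSubtypeProd, i.2])
    (fun v v' => sum_prod_map_single (fun i : {i // ¬ i ∈ S} => Φ i) v v')
  exact h

theorem reduceToSingle_trLeft_idTensorPi [Fintype R] (Φ : ∀ i, QuantumOp (A i) (B i)) (j : ι)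
    (X : Matrix (R × ∀ i, A i) (R × ∀ i, A i) ℂ) :
    reduceToSingle j (trLeft (idTensorPi R (fun i => (Φ i).map) X)) =
      (Φ j).map (reduceToSingle j (trLeft X)) := by
  ext y y'
  rw [linearMap_apply_eq_sum]
  have h := sum_coeff_factor (Equiv.piSplitAt j A).symm
    (fun x x' => trLeft X x x')
    (fun x x' (z : ∀ i : {i // i ≠ j}, B i) => ∏ i, (Φ i).map (Matrix.single (x i) (x' i) 1)
      ((Equiv.piSplitAt j B).symm (y, z) i)
      ((Equiv.piSplitAt j B).symm (y', z) i))
    (fun u u' => (Φ j).map (Matrix.single u u' 1) y y')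
    (fun v v' z => ∏ i : {i // i ≠ j}, (Φ i).map (Matrix.single (v i) (v' i) 1) (z i) (z i))
    (fun u u' v v' z => by
      rw [Fintype.prod_eq_mul_prod_subtype_ne _ j]
      congr 1
      · simp [Equiv.piSplitAt]
      · refine Finset.prod_congr rfl fun i _ => ?_
        simp [Equiv.piSplitAt, i.2])
    (fun v v' => sum_prod_map_single (fun i : {i // i ≠ j} => Φ i) v v')
  refine Eq.trans ?_ h
  simp only [reduceToSingle, trRight, trLeft, idTensorPi, of_apply, reindex_apply,
    submatrix_apply, Finset.sum_mul]
  refine Finset.sum_congr rfl fun z _ => ?_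
  rw [Finset.sum_comm]
  refine Finset.sum_congr rfl fun x _ => ?_
  rw [Finset.sum_comm]

omit [∀ i, Fintype (B i)] in
theorem idTensorPi_kronecker (Φ : ∀ i, Matrix (A i) (A i) ℂ →ₗ[ℂ] Matrix (B i) (B i) ℂ)
    (α : Matrix R R ℂ) (τ : Matrix (∀ i, A i) (∀ i, A i) ℂ) :
    ∃ τ', idTensorPi R Φ (α ⊗ₖ τ) = α ⊗ₖ τ' := by
  refine ⟨of fun y y' => ∑ x, ∑ x', τ x x' *
    ∏ i, Φ i (Matrix.single (x i) (x' i) 1) (y i) (y' i), ?_⟩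
  ext ⟨r, y⟩ ⟨r', y'⟩
  simp only [idTensorPi, of_apply, kronecker_apply, Finset.mul_sum, mul_assoc]

omit [∀ i, DecidableEq (A i)] in
/-- Reducing in two steps gives a product state if reducing in one step does. -/
theorem reduceTo_reduceTo_eq_kronecker [Fintype R] {D : Finset ι} (S : Finset {i // i ∈ D})
    {X : Matrix (R × ∀ i, A i) (R × ∀ i, A i) ℂ} {α : Matrix R R ℂ}
    {τ : Matrix (∀ i : {i // i ∈ S.map (Function.Embedding.subtype _)}, A i)
      (∀ i : {i // i ∈ S.map (Function.Embedding.subtype _)}, A i) ℂ}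
    (h : reduceTo (S.map (Function.Embedding.subtype _)) X = α ⊗ₖ τ) :
    ∃ τ', reduceTo S (reduceTo D X) = α ⊗ₖ τ' := by
  have hmem : ∀ i, i ∈ S.map (Function.Embedding.subtype _) ↔
      ∃ h : i ∈ D, (⟨i, h⟩ : {i // i ∈ D}) ∈ S := by
    simp
  let g : (∀ i : {i // i ∈ S}, A i.1) →
      ∀ i : {i // i ∈ S.map (Function.Embedding.subtype _)}, A i :=
    fun x i => x ⟨⟨i.1, ((hmem i.1).1 i.2).1⟩, ((hmem i.1).1 i.2).2⟩
  refine ⟨of fun x x' => τ (g x) (g x'), ?_⟩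
  ext ⟨r, x⟩ ⟨r', x'⟩
  rw [kronecker_apply, of_apply]
  refine Eq.trans ?_ ((congrFun (congrFun h (r, g x)) (r', g x')).trans (kronecker_apply ..))
  rw [reduceTo_eq_marg, reduceTo_eq_marg, reduceTo_eq_marg, marg_marg]
  have hg : ∀ (t : R × ∀ i, A i) (r : R) (x : ∀ i : {i // i ∈ S}, A i.1),
      (t.1, fun i : {i // i ∈ S} => t.2 i.1) = (r, x) ↔
        (t.1, fun i : {i // i ∈ S.map (Function.Embedding.subtype _)} => t.2 i) = (r, g x) := by
    intro t r x
    simp only [Prod.ext_iff, funext_iff]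
    refine and_congr_right fun _ => ⟨fun h i =>
      h ⟨⟨i.1, ((hmem i.1).1 i.2).1⟩, ((hmem i.1).1 i.2).2⟩, fun h i => h ⟨i.1, ?_⟩⟩
    exact (hmem _).2 ⟨i.1.2, i.2⟩
  refine marg_apply_eq (fun t t' => ?_) X
  refine and_congr (hg t r x) (and_congr (hg t' r' x') ⟨fun h i hi => ?_, fun h => ⟨?_, ?_⟩⟩)
  · by_cases hD : i ∈ D
    · exact h.1 ⟨i, hD⟩ fun hS => hi ((hmem i).2 ⟨hD, hS⟩)
    · exact h.2 i hD
  · exact fun i hi => h i fun hm => hi ((hmem i).1 hm).2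
  · exact fun i hi => h i fun hm => hi ((hmem i).1 hm).1

omit [∀ i, DecidableEq (A i)] in
theorem reduceToSingle_trLeft_reduceTo [Fintype R] {D : Finset ι} (j : {i // i ∈ D})
    (X : Matrix (R × ∀ i, A i) (R × ∀ i, A i) ℂ) :
    reduceToSingle j (trLeft (reduceTo D X)) = reduceToSingle j.1 (trLeft X) := by
  rw [reduceToSingle_eq_marg, reduceToSingle_eq_marg, reduceTo_eq_marg, trLeft_eq_marg,
    trLeft_eq_marg, marg_marg, marg_marg, marg_marg]
  refine marg_congr (fun t t' => ⟨fun h => ⟨fun i hi => ?_, h.1.2⟩,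
    fun h => ⟨⟨fun i hi => h.1 i fun hij => hi (Subtype.ext hij), h.2⟩,
      fun i hi => h.1 i fun hij => hi (hij ▸ j.2)⟩⟩) X
  by_cases hD : i ∈ D
  · exact h.1.1 ⟨i, hD⟩ fun hij => hi (congrArg Subtype.val hij)
  · exact h.2 i hD

end Pi

theorem trLeft_idTensor {A B R : Type*} [Fintype R] (Φ : Matrix A A ℂ →ₗ[ℂ] Matrix B B ℂ)
    (X : Matrix (R × A) (R × A) ℂ) : trLeft (idTensor R Φ X) = Φ (trLeft X) := by
  have : trLeft X = ∑ r, of fun a a' => X (r, a) (r, a') := by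
    ext a a'
    simp [trLeft, Matrix.sum_apply]
  ext b b'
  rw [this, map_sum, Matrix.sum_apply]
  rfl

theorem trRight_idTensor {A B R : Type*} [Fintype A] [Fintype B] (Φ : QuantumOp A B)
    (X : Matrix (R × A) (R × A) ℂ) : trRight (idTensor R Φ.map X) = trRight X := by
  ext r r'
  exact Φ.trace_map (of fun a a' => X (r, a) (r', a'))

/-- If every `m`-element subset has weight at least `s`, then the total weight is at least
`s * d / m`, where `d` is the number of all elements. -/
theorem card_mul_le_of_forall_card_eq {ι : Type*} [Fintype ι] {m : ℕ}
    (hm : m ≤ Fintype.card ι) (f : ι → ℝ) {s : ℝ}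
    (h : ∀ L : Finset ι, L.card = m → s ≤ ∑ j ∈ L, f j) :
    Fintype.card ι * s ≤ m * ∑ j, f j := by
  rcases Nat.eq_zero_or_pos (Fintype.card ι) with h0 | h0
  · have : m = 0 := by omega
    simp [h0, this]
  have : NeZero (Fintype.card ι) := ⟨h0.ne'⟩
  -- Arrange the elements on a cycle. The windows of `m` consecutive elements, with wrap-around
  -- addition in `Fin`, number as many as the elements, and each element lies in exactly `m` of
  -- them.
  let e := Fintype.equivFin ι
  have hL : ∀ i : Fin (Fintype.card ι), s ≤ ∑ t : Fin m, f (e.symm (i + Fin.castLE hm t)) := by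
    intro i
    let g : Fin m ↪ ι := ⟨fun t => e.symm (i + Fin.castLE hm t), fun t t' ht => by simpa using ht⟩
    exact (h (Finset.univ.map g) (by simp)).trans_eq (Finset.sum_map _ _ _)
  calc Fintype.card ι * s = ∑ _i : Fin (Fintype.card ι), s := by simp
    _ ≤ ∑ i : Fin (Fintype.card ι), ∑ t : Fin m, f (e.symm (i + Fin.castLE hm t)) :=
        Finset.sum_le_sum fun i _ => hL i
    _ = ∑ _t : Fin m, ∑ j, f j := by
        rw [Finset.sum_comm]
        refine Finset.sum_congr rfl fun t _ => ?_
        rw [← e.symm.sum_comp f]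
        exact Equiv.sum_comp (Equiv.addRight (Fin.castLE hm t)) fun i => f (e.symm i)
    _ = m * ∑ j, f j := by simp

/-! ### Entropy bounds for the partial shares of a protocol -/

namespace Protocol

variable {n M : ℕ} (P : Protocol n M) {r : ℕ} {ψ : Fin r × Fin M → ℂ}

theorem isDensity_sharesState (hψ : IsUnitVector ψ) : IsDensity (P.sharesState ψ) := by
  have h := isDensity_pureState hψ
  refine ⟨P.encode.completely_positive r _ h.1, ?_⟩
  rw [sharesState, ← trace_trRight, trRight_idTensor, trace_trRight, h.2]

theorem isDensity_partialsState (hψ : IsUnitVector ψ) (D : Finset (Fin n)) :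
    IsDensity (P.partialsState ψ D) := by
  have h := isDensity_reduceTo (P.isDensity_sharesState hψ) D
  refine ⟨posSemidef_idTensorPi (P.partialOp D) h.1, ?_⟩
  rw [partialsState, ← trace_trRight, trRight_idTensorPi (P.partialOp D), trace_trRight, h.2]

theorem trRight_partialsState (ψ : Fin r × Fin M → ℂ) (D : Finset (Fin n)) :
    trRight (P.partialsState ψ D) = trRight (pureState ψ) := by
  rw [partialsState, trRight_idTensorPi (P.partialOp D), trRight_reduceTo, sharesState,
    trRight_idTensor]

theorem reduceToSingle_partialsState (ψ : Fin r × Fin M → ℂ) (D : Finset (Fin n))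
    (j : {j // j ∈ D}) :
    reduceToSingle j (trLeft (P.partialsState ψ D)) = P.partialState ψ D j := by
  rw [partialsState, reduceToSingle_trLeft_idTensorPi (P.partialOp D),
    reduceToSingle_trLeft_reduceTo, sharesState, trLeft_idTensor]
  rfl

/-- Local processing creates no correlation: vanishing information means a product state, and
operations on the shares alone keep it a product. This replaces the data-processing inequality. -/
theorem mutualInfo_reduceTo_partialsState (hψ : IsUnitVector ψ) {D : Finset (Fin n)}
    (S : Finset {j // j ∈ D}) (h : P.NoInformation ψ (S.map (Function.Embedding.subtype _))) :
    mutualInfo (reduceTo S (P.partialsState ψ D)) = 0 := by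
  have h1 := eq_kronecker_of_mutualInfo_eq_zero
    (isDensity_reduceTo (P.isDensity_sharesState hψ) _) h
  obtain ⟨τ, hτ⟩ := reduceTo_reduceTo_eq_kronecker S h1
  generalize trRight (reduceTo _ (P.sharesState ψ)) = α at hτ
  obtain ⟨τ', hτ'⟩ := idTensorPi_kronecker
    (fun j : {j // j ∈ S} => (P.partialOp D j).map) α τ
  refine mutualInfo_eq_zero_of_eq_kronecker
    (isDensity_reduceTo (P.isDensity_partialsState hψ D) S) (α := α) (β := τ') ?_
  rw [partialsState, reduceTo_idTensorPi (P.partialOp D), hτ, hτ']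

/-- The partial shares outside of a set without information carry at least the entropy of the
secret. -/
theorem entropy_secretState_le_sum (hψ : IsUnitVector ψ) {D : Finset (Fin n)}
    (hrec : P.PartialsRecover ψ D) (L : Finset {j // j ∈ D})
    (h : P.NoInformation ψ (Lᶜ.map (Function.Embedding.subtype _))) :
    entropy (secretState ψ) ≤ ∑ j ∈ L, entropy (P.partialState ψ D j) := by
  have hY := P.isDensity_partialsState hψ D
  have h1 := P.mutualInfo_reduceTo_partialsState hψ Lᶜ h
  rw [mutualInfo, trRight_reduceTo, trLeft_reduceTo, trRight_partialsState,
    entropy_trRight_pureState] at h1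
  have h2 := entropy_reduceTo_le hY Lᶜ
  have h3 := entropy_le_margPi_add_compl hY.trLeft L
  rw [PartialsRecover, mutualInfo_pureState hψ, mutualInfo, trRight_partialsState,
    entropy_trRight_pureState] at hrec
  have h4 := entropy_margPi_le_sum hY.trLeft L
  simp only [reduceToSingle_partialsState] at h4
  rw [compl_compl] at h2
  -- What remains is linear: `h1` (secrecy), `hrec` (recovery), `h2` (Araki-Lieb) and `h3`
  -- (subadditivity) give twice the desired bound with the joint entropy of `L`, and `h4` splits
  -- that entropy into single parties.
  rw [secretState]
  linarith

theorem mul_entropy_secretState_le {k d : ℕ} (hk : 1 ≤ k) (hkd : k ≤ d) {D : Finset (Fin n)}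
    (hD : D.card = d) (hψ : IsUnitVector ψ)
    (hsec : ∀ B : Finset (Fin n), B.card < k → P.NoInformation ψ B)
    (hrec : P.PartialsRecover ψ D) :
    (d : ℝ) / ((d : ℝ) - k + 1) * entropy (secretState ψ) ≤
      ∑ j : {j // j ∈ D}, entropy (P.partialState ψ D j) := by
  have hc : Fintype.card {j // j ∈ D} = d := by simp [hD]
  -- The size `d - k + 1` is the smallest whose complement in `D` has fewer than `k` elements, so
  -- secrecy applies to the complement.
  have h := card_mul_le_of_forall_card_eq (ι := {j // j ∈ D}) (m := d - k + 1) (by omega)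
    (fun j => entropy (P.partialState ψ D j)) (s := entropy (secretState ψ)) fun L hL =>
      P.entropy_secretState_le_sum hψ hrec L <| hsec _ <| by
        rw [Finset.card_map, Finset.card_compl, hc, hL]
        omega
  rw [hc] at h
  push_cast [Nat.cast_sub hkd] at h
  have hpos : (0 : ℝ) < (d : ℝ) - k + 1 := by
    have : (k : ℝ) ≤ d := by exact_mod_cast hkd
    linarith
  rw [div_mul_eq_mul_div, div_le_iff₀ hpos]
  linarith

theorem isDensity_partialState (hψ : IsUnitVector ψ) (D : Finset (Fin n)) (j : {j // j ∈ D}) :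
    IsDensity (P.partialState ψ D j) := by
  rw [← reduceToSingle_partialsState]
  exact ((P.isDensity_partialsState hψ D).trLeft.submatrix_equiv _).trRight

end Protocol

/-! ### The dimension bound, from a maximally entangled secret -/

/-- The maximally entangled state vector. -/
noncomputable def maxEntangled (M : ℕ) : Fin M × Fin M → ℂ :=
  fun p => if p.1 = p.2 then ((Real.sqrt (M : ℝ)⁻¹ : ℝ) : ℂ) else 0

theorem isUnitVector_maxEntangled {M : ℕ} (hM : M ≠ 0) : IsUnitVector (maxEntangled M) := by
  have : (0 : ℝ) ≤ (M : ℝ)⁻¹ := by positivity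
  have hM' : (M : ℝ) ≠ 0 := by exact_mod_cast hM
  simp only [IsUnitVector, maxEntangled, Fintype.sum_prod_type, apply_ite norm,
    Complex.norm_real, norm_zero, ite_pow, Real.norm_eq_abs, sq_abs, Real.sq_sqrt this]
  simp [hM']

theorem entropy_secretState_maxEntangled {M : ℕ} (hM : M ≠ 0) :
    entropy (Protocol.secretState (maxEntangled M)) = Real.log M := by
  have h0 : (0 : ℝ) ≤ (M : ℝ)⁻¹ := by positivity
  have hM' : (M : ℝ) ≠ 0 := by exact_mod_cast hM
  have : Protocol.secretState (maxEntangled M) = diagonal fun _ => (((M : ℝ)⁻¹ : ℝ) : ℂ) := by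
    ext i j
    simp only [Protocol.secretState, trLeft, pureState, vecMulVec_apply, maxEntangled, of_apply,
      Pi.star_apply, apply_ite star, star_zero, mul_ite, mul_zero, ite_mul, zero_mul,
      Complex.star_def, Complex.conj_ofReal, ← Complex.ofReal_mul, Real.mul_self_sqrt h0,
      Finset.sum_ite_eq', Finset.mem_univ, if_true, diagonal_apply,
      eq_comm (a := j)]
  rw [this, entropy_diagonal]
  simp [Real.negMulLog, hM']

theorem Protocol.rpow_le_prod_partialDim {n M : ℕ} (P : Protocol n M) {k d : ℕ} (hk : 1 ≤ k)
    (hkd : k ≤ d) {D : Finset (Fin n)} (hD : D.card = d) (hsec : P.Secrecy k)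
    (hrec : P.PartialRecoverability D) :
    (M : ℝ) ^ ((d : ℝ) / ((d : ℝ) - k + 1)) ≤ ∏ j : {j // j ∈ D}, (P.partialDim D j : ℝ) := by
  have hkd' : (k : ℝ) ≤ d := by exact_mod_cast hkd
  have hk' : (1 : ℝ) ≤ k := by exact_mod_cast hk
  -- For `M = 0` there is no state vector to test with, but the left side is 0 because the exponent
  -- is positive.
  rcases Nat.eq_zero_or_pos M with rfl | hM
  · rw [Nat.cast_zero, Real.zero_rpow (div_pos (by linarith) (by linarith)).ne']
    exact Finset.prod_nonneg fun _ _ => Nat.cast_nonneg _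
  have hψ := isUnitVector_maxEntangled hM.ne'
  have h := P.mul_entropy_secretState_le hk hkd hD hψ (hsec M _ hψ) (hrec M _ hψ)
  rw [entropy_secretState_maxEntangled hM.ne'] at h
  -- A system that carries a density matrix has positive dimension, so logarithms can be taken
  -- factor by factor.
  have hdim : ∀ j, (0 : ℝ) < P.partialDim D j := by
    intro j
    have := (P.isDensity_partialState hψ D j).nonempty
    exact_mod_cast Fin.pos_iff_nonempty.2 this
  have h2 : ∑ j, entropy (P.partialState (maxEntangled M) D j) ≤
      ∑ j, Real.log (P.partialDim D j) :=
    Finset.sum_le_sum fun j _ => by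
      simpa using (P.isDensity_partialState hψ D j).entropy_le_log_card
  have hM' : (0 : ℝ) < M := by exact_mod_cast hM
  rw [← Real.log_le_log_iff (Real.rpow_pos_of_pos hM' _) (Finset.prod_pos fun j _ => hdim j),
    Real.log_rpow hM', Real.log_prod fun j _ => (hdim j).ne']
  exact h.trans h2

end QSS

theorem mainTheorem4 {n M : ℕ} (P : QSS.Protocol n M) (k d : ℕ) (hk : 1 ≤ k) (hkd : k ≤ d)
    (D : Finset (Fin n)) (hD : D.card = d) :
    (∀ (r : ℕ) (ψ : Fin r × Fin M → ℂ), QSS.IsUnitVector ψ →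
      (∀ B : Finset (Fin n), B.card < k → P.NoInformation ψ B) → P.PartialsRecover ψ D →
        (d : ℝ) / ((d : ℝ) - k + 1) * QSS.entropy (QSS.Protocol.secretState ψ) ≤
          ∑ j : {j // j ∈ D}, QSS.entropy (P.partialState ψ D j)) ∧
    ((P.IsThresholdScheme k ∧ P.PartialRecoverability D) ∨ P.IsCEQTS k d ∨ P.IsUniversalCEQTS k →
      (M : ℝ) ^ ((d : ℝ) / ((d : ℝ) - k + 1)) ≤
        ∏ j : {j // j ∈ D}, (P.partialDim D j : ℝ)) := by
  refine ⟨fun r ψ hψ hsec hrec => P.mul_entropy_secretState_le hk hkd hD hψ hsec hrec, ?_⟩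
  rintro (⟨⟨-, hsec⟩, hrec⟩ | ⟨-, hrec, hsec, -⟩ | ⟨hrec, hsec, -⟩)
  · exact P.rpow_le_prod_partialDim hk hkd hD hsec hrec
  · exact P.rpow_le_prod_partialDim hk hkd hD hsec (hrec D hD)
  · exact P.rpow_le_prod_partialDim hk hkd hD hsec (hrec D (hD ▸ hkd))
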